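/- Let $\overline{\mathbb{Q}}$ be the field of algebraic numbers, $\mathcal{G}=\overline{\mathbb{Q}}^{\times}/\mathrm{Tor}(\overline{\mathbb{Q}}^{\times})$, and $Y$ the set of places $y$ of $\overline{\mathbb{Q}}$. For a place $v$ of a number field $k$ let $\|\cdot\|_v$ be the absolute value in $v$ that restricts to the usual real or $p$-adic absolute value on $\mathbb{Q}$, let $[k_v:\mathbb{Q}_v]$ be the local degree, and define $\|\cdot\|_y$ for $y\in Y$ in the same way. For $k\subseteq\overline{\mathbb{Q}}$ put $Y(k,v)=\{y\in Y: y\mid v\}$. Give $Y$ the topology generated by the sets $Y(l,w)$ with $l/\mathbb{Q}$ finite Galois and $w$ a place of $l$, and let $\lambda$ be the unique regular Borel measure on $Y$ that is invariant under $\mathrm{Aut}(\overline{\mathbb{Q}}/\mathbb{Q})$ and satisfies $\lambda(Y(l,w))=[l_w:\mathbb{Q}_w]/[l:\mathbb{Q}]$ for all such $l$ and $w$. For $\alpha\in\mathcal{G}$ let $f_\alpha(y)=\log\|\alpha\|_y$. The height of a finitely generated subgroup $\mathfrak{A}\subseteq\mathcal{G}$ with $\mathbb{Z}$-basis $\alpha_1,\dots,\alpha_N$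 is $$h(\mathfrak{A})=2^{-N}\int_{Y^N}\bigl|\det\bigl(f_{\alpha_l}(y_n)\bigr)_{l,n}\bigr|\,d\lambda^N(y_1,\dots,y_N),$$ which does not depend on the basis. Let $k\subseteq\overline{\mathbb{Q}}$ be a number field and $S$ a finite set of places of $k$ that contains all archimedean places, with $|S|=s\ge 2$. Let $U_S(k)=\{\gamma\in k^{\times}:\|\gamma\|_v=1\text{ for all }v\notin S\}$, and let $\mathfrak{U}_S(k)$ be its image in $\mathcal{G}$. Let $\mathrm{Reg}_S(k)=\bigl|\det\bigl([k_v:\mathbb{Q}_v]\log\|\eta_l\|_v\bigr)\bigr|$ be the $S$-regulator, where $\eta_1,\dots,\eta_{s-1}$ is a fundamental system of $S$-units (a $\mathbb{Z}$-basis of $U_S(k)$ modulo torsion) and $v$ runs through all but one of the places in $S$. Then $\mathfrak{U}_S(k)$ is finitely generated of rank $s-1$, and $$h\bigl(\mathfrak{U}_S(k)\bigr)=\frac{s!\,\mathrm{Reg}_S(k)}{\bigl(2[k:\mathbb{Q}]\bigr)^{s-1}}.$$ -/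

import Mathlib

open MeasureTheory
open scoped ENNReal Nat

/-- The field of algebraic numbers. -/
abbrev Qbar : Type := AlgebraicClosure ℚ

/-- A place of an algebraic extension `K` of `ℚ`, given by its normalized absolute value `‖·‖_v`:
the representative of the equivalence class which restricts on `ℚ` to the usual real absolute
value or to the usual `p`-adic absolute value for a prime `p`.  (By Ostrowski's theorem every
equivalence class of nontrivial absolute values contains exactly one such absolute value.) -/
@[ext]
structure Place (K : Type*) [Field K] [CharZero K] where
  /-- The normalized absolute value `‖·‖_v`. -/
  abv : AbsoluteValue K ℝ
  normalized : (∀ q : ℚ, abv (q : K) = Rat.AbsoluteValue.real q) ∨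
    ∃ (p : ℕ) (_ : Fact p.Prime), ∀ q : ℚ, abv (q : K) = Rat.AbsoluteValue.padic p q

namespace Place

/-- `v ∣ ∞`: the place is archimedean. -/
def IsArchimedean {K : Type*} [Field K] [CharZero K] (v : Place K) : Prop :=
  ∀ q : ℚ, v.abv (q : K) = Rat.AbsoluteValue.real q

/-- The place of `K` lying below a place `w` of `L`. -/
def restrict (K : Type*) {L : Type*} [Field K] [CharZero K] [Field L] [CharZero L] [Algebra K L]
    (w : Place L) : Place K where
  abv := w.abv.comp (algebraMap K L).injective
  normalized := by
    have h : ∀ q : ℚ, w.abv.comp (algebraMap K L).injective (q : K) = w.abv (q : L) := fun q =>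
      congrArg w.abv (map_ratCast (algebraMap K L) q)
    simpa only [h] using w.normalized

/-- The local degree `[K_v : ℚ_v]`, where `K_v` is the completion of `K` at `v` and `ℚ_v` is the
closure of the prime field `ℚ` in `K_v`. -/
noncomputable def localDegree {K : Type*} [Field K] [CharZero K] (v : Place K) : ℕ :=
  Module.finrank (⊥ : Subfield v.abv.Completion).topologicalClosure v.abv.Completion

/-- `Y(K, v)`: the set of places of the field of algebraic numbers lying over `v`. -/
def fiber {K : Type*} [Field K] [CharZero K] [Algebra K Qbar] (v : Place K) : Set (Place Qbar) :=
  {y | y.restrict K = v}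

/-- The topology on the space `Y` of all places of the field of algebraic numbers, generated by
the sets `Y(l, w)` where `l` is a finite Galois extension of `ℚ` and `w` is a place of `l`. -/
instance : TopologicalSpace (Place Qbar) :=
  TopologicalSpace.generateFrom
    {E | ∃ l : IntermediateField ℚ Qbar, FiniteDimensional ℚ l ∧ IsGalois ℚ l ∧
      ∃ w : Place l, E = w.fiber}

/-- The Borel `σ`-algebra of `Y`. -/
instance : MeasurableSpace (Place Qbar) := borel (Place Qbar)

instance : BorelSpace (Place Qbar) := ⟨rfl⟩

/-- The action of the absolute Galois group on `Y`: `‖α‖_{τ y} = ‖τ⁻¹ α‖_y`. -/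
noncomputable def galois (τ : Qbar ≃ₐ[ℚ] Qbar) (y : Place Qbar) : Place Qbar where
  abv := y.abv.comp (f := (τ.symm : Qbar →+* Qbar)) τ.symm.injective
  normalized := by
    have h : ∀ q : ℚ, y.abv.comp (f := (τ.symm : Qbar →+* Qbar)) τ.symm.injective (q : Qbar) =
        y.abv (q : Qbar) := fun q =>
      congrArg y.abv (map_ratCast (τ.symm : Qbar →+* Qbar) q)
    simpa only [h] using y.normalized

end Place

/-- The property that characterizes the normalized invariant measure `λ` on the Borel subsets of
`Y`: it is regular, it is invariant under the absolute Galois group, and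
`λ(Y(l, w)) = [l_w : ℚ_w] / [l : ℚ]` for every finite Galois extension `l / ℚ` and every place `w`
of `l`. -/
structure IsNormalizedInvariant (μ : Measure (Place Qbar)) : Prop where
  regular : μ.Regular
  invariant : ∀ (τ : Qbar ≃ₐ[ℚ] Qbar) (E : Set (Place Qbar)), MeasurableSet E →
    μ (Place.galois τ '' E) = μ E
  fiber : ∀ l : IntermediateField ℚ Qbar, FiniteDimensional ℚ l → IsGalois ℚ l →
    ∀ w : Place l, μ w.fiber = (w.localDegree : ℝ≥0∞) / (Module.finrank ℚ l : ℝ≥0∞)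

/-- The measure `λ`: the unique regular Borel measure on `Y` which is Galois invariant and
satisfies `λ(Y(l, w)) = [l_w : ℚ_w] / [l : ℚ]` for all finite Galois extensions `l / ℚ`. -/
noncomputable def placeMeasure : Measure (Place Qbar) :=
  Classical.epsilon IsNormalizedInvariant

/-- The multiplicative group `𝒢` of nonzero algebraic numbers modulo torsion. -/
abbrev GroupG : Type := Qbarˣ ⧸ CommGroup.torsion Qbarˣ

/-- A root of unity has absolute value one. -/
lemma abv_eq_one_of_isOfFinOrder {K : Type*} [Field K] (v : AbsoluteValue K ℝ) {u : Kˣ}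
    (hu : IsOfFinOrder u) : v (u : K) = 1 := by
  obtain ⟨n, hn, h⟩ := isOfFinOrder_iff_pow_eq_one.1 hu
  have h1 : v (u : K) ^ n = 1 := by
    rw [← map_pow, ← Units.val_pow_eq_pow_val, h, Units.val_one, map_one]
  exact (pow_eq_one_iff_of_nonneg (v.nonneg _) hn.ne').1 h1

/-- The homomorphism `u ↦ log ‖u‖_v`, written multiplicatively. -/
noncomputable def logAbv {K : Type*} [Field K] (v : AbsoluteValue K ℝ) :
    Kˣ →* Multiplicative ℝ where
  toFun u := Multiplicative.ofAdd (Real.log (v (u : K)))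
  map_one' := by simp
  map_mul' a b := by
    rw [Units.val_mul, map_mul,
      Real.log_mul (v.ne_zero a.ne_zero) (v.ne_zero b.ne_zero), ofAdd_add]

/-- The function `f_α(y) = log ‖α‖_y` on `Y` attached to a point `α` of `𝒢`. -/
noncomputable def logFun (α : GroupG) (y : Place Qbar) : ℝ :=
  (QuotientGroup.lift (CommGroup.torsion Qbarˣ) (logAbv y.abv) (fun u hu => by
    have h := abv_eq_one_of_isOfFinOrder y.abv (K := Qbar) (u := u) hu
    simp [MonoidHom.mem_ker, logAbv, h]) α).toAdd

/-- `Δ(F₁, …, F_N; x) = det (F_l(x_n))`. -/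
noncomputable def deltaDet {X : Type*} {N : ℕ} (F : Fin N → X → ℝ) (x : Fin N → X) : ℝ :=
  (Matrix.of fun l n : Fin N => F l (x n)).det

open Classical in
/-- The height of a finitely generated subgroup `A` of `𝒢` of rank `N`:
`h(A) = 2⁻ᴺ ∫_{Yᴺ} |Δ(f_{α₁}, …, f_{α_N}; y)| dλᴺ(y)`, where `α₁, …, α_N` is a basis of the
`ℤ`-module `A`; the value does not depend on the basis.  (The value for subgroups without a finite
basis is irrelevant.) -/
noncomputable def height (A : Subgroup GroupG) : ℝ :=
  if h : Nonempty (Module.Basis (Fin (Module.finrank ℤ (Additive A))) ℤ (Additive A)) then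
    (2 ^ Module.finrank ℤ (Additive A))⁻¹ *
      ∫ y : Fin (Module.finrank ℤ (Additive A)) → Place Qbar,
        |deltaDet (fun l => logFun ((h.some l).toMul : GroupG)) y|
          ∂(Measure.pi fun _ => placeMeasure)
  else 0

section SUnits

/-- The group `U_S(k)` of `S`-units. -/
def sUnits {k : Type*} [Field k] [CharZero k] (S : Finset (Place k)) : Subgroup kˣ where
  carrier := {γ | ∀ v : Place k, v ∉ S → v.abv (γ : k) = 1}
  one_mem' := fun v _ => by simp
  mul_mem' := fun {a b} ha hb v hv => by
    rw [Units.val_mul, map_mul, ha v hv, hb v hv, mul_one]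
  inv_mem' := fun {a} ha v hv => by
    rw [Units.val_inv_eq_inv_val, map_inv₀, ha v hv, inv_one]

/-- The image `𝔘_S(k)` of `U_S(k)` in `𝒢`. -/
noncomputable def sUnitsImage {k : Type*} [Field k] [CharZero k] [Algebra k Qbar]
    (S : Finset (Place k)) : Subgroup GroupG :=
  (sUnits S).map
    ((QuotientGroup.mk' (CommGroup.torsion Qbarˣ)).comp
      (Units.map (algebraMap k Qbar : k →* Qbar)))

/-- A family of `S`-units is a fundamental system if its image in the quotient of `U_S(k)` by its
torsion subgroup is a `ℤ`-basis. -/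
def IsFundamentalSystem {k : Type*} [Field k] [CharZero k] (S : Finset (Place k)) {ι : Type*}
    (η : ι → sUnits S) : Prop :=
  ∃ b : Module.Basis ι ℤ (Additive (sUnits S ⧸ CommGroup.torsion (sUnits S))),
    ∀ i, b i = Additive.ofMul (QuotientGroup.mk (η i))

/-- The choices that enter the definition of the `S`-regulator: a place `v₀ ∈ S` to be left out,
and a fundamental system of `S`-units, indexed by the remaining places of `S`. -/
structure RegulatorData {k : Type*} [Field k] [CharZero k] (S : Finset (Place k)) where
  /-- The place that is left out. -/
  v₀ : Place k
  mem : v₀ ∈ S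
  /-- The fundamental system. -/
  η : {v : Place k // v ∈ S ∧ v ≠ v₀} → sUnits S
  fundamental : IsFundamentalSystem S η

open Classical in
/-- The `S`-regulator `Reg_S(k) = |det ([k_v : ℚ_v] log ‖η_l‖_v)|`, where `(η_l)` is a fundamental
system of `S`-units and `v` runs through all places in `S` but one; the value does not depend on
the choices. -/
noncomputable def sRegulator {k : Type*} [Field k] [CharZero k] (S : Finset (Place k)) : ℝ :=
  if h : Nonempty (RegulatorData S) then
    haveI : Fintype {v : Place k // v ∈ S ∧ v ≠ h.some.v₀} :=
      Fintype.ofFinset (S.erase h.some.v₀) (fun v => by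
        rw [Finset.mem_erase, and_comm]; rfl)
    |(Matrix.of fun l v : {v : Place k // v ∈ S ∧ v ≠ h.some.v₀} =>
      (v.1.localDegree : ℝ) * Real.log (v.1.abv ((h.some.η l : kˣ) : k))).det|
  else 0

end SUnits

/-!
Embeddings of a number field `k` in `ℚ̄` that induce `v` from a fixed place of `ℚ̄` over the same
place of `ℚ` correspond to `ℚ_v`-embeddings of the completion `k_v`, so there are `[k_v : ℚ_v]` of
them. The image of Haar measure on the absolute Galois group on the orbit of places over `q`
therefore gives `Y(k, v)` the mass `[k_v : ℚ_v] / [k : ℚ]`; the sum of these images over all `q`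
is a measure as in the definition of `λ`. On `𝔘_S(k)` the functions `f_α` are constant on each
`Y(k, v)` and vanish for `v ∉ S`. The integral is thus, up to the factor `[k : ℚ] ^ (s - 1)`, the
sum of the absolute values of all determinants formed from `s - 1` columns of the `(s - 1) × s`
matrix `([k_v : ℚ_v] log ‖η_l‖_v)`. Its rows sum to zero by the product formula, so each of the
`s!` injective choices of columns contributes `Reg_S(k)`, and the other choices contribute zero.
-/

namespace Place

section Basic

variable {K L M : Type*} [Field K] [CharZero K] [Field L] [CharZero L] [Field M] [CharZero M]

/-- The pullback of a place along a field embedding; `restrict` is the case of an `algebraMap`. -/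
def comap (σ : K →+* L) (w : Place L) : Place K where
  abv := w.abv.comp σ.injective
  normalized := by
    have h (q : ℚ) : w.abv.comp σ.injective (q : K) = w.abv (q : L) :=
      congrArg w.abv (map_ratCast σ q)
    simpa only [h] using w.normalized

@[simp] lemma comap_abv_apply (σ : K →+* L) (w : Place L) (x : K) :
    (comap σ w).abv x = w.abv (σ x) := rfl

lemma comap_comap (σ : K →+* L) (τ : L →+* M) (w : Place M) :
    comap σ (comap τ w) = comap (τ.comp σ) w := rfl

lemma restrict_eq_comap [Algebra K L] (w : Place L) :
    w.restrict K = comap (algebraMap K L) w := rfl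

lemma ext_abv {v w : Place K} (h : ∀ x, v.abv x = w.abv x) : v = w :=
  Place.ext (AbsoluteValue.ext h)

/-- The normalized absolute values of `ℚ`, indexed by the primes and by `none`, which stands for
the archimedean place. -/
noncomputable def ratAbv : Option Nat.Primes → AbsoluteValue ℚ ℝ
  | none => Rat.AbsoluteValue.real
  | some p => haveI : Fact p.1.Prime := ⟨p.2⟩; Rat.AbsoluteValue.padic p.1

lemma ratAbv_none (x : ℚ) : ratAbv none x = |(x : ℝ)| := rfl

lemma ratAbv_some (p : Nat.Primes) (x : ℚ) : ratAbv (some p) x = padicNorm p x := rfl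

lemma ratAbv_some_intCast_le_one (p : Nat.Primes) (n : ℤ) : ratAbv (some p) (n : ℚ) ≤ 1 := by
  have : Fact p.1.Prime := ⟨p.2⟩
  exact Rat.AbsoluteValue.padic_le_one p.1 n

lemma ratAbv_some_natCast_lt_one_iff (p : Nat.Primes) (n : ℕ) :
    ratAbv (some p) (n : ℚ) < 1 ↔ p.1 ∣ n := by
  have : Fact p.1.Prime := ⟨p.2⟩
  rw [ratAbv_some, ← padicNorm.nat_lt_one_iff]
  norm_cast

lemma exists_ratAbv_lt_one (q : Option Nat.Primes) :
    ∃ a : ℚ, 0 < ratAbv q a ∧ ratAbv q a < 1 := by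
  rcases q with _ | p
  · exact ⟨1 / 2, by norm_num [ratAbv], by norm_num [ratAbv, abs_lt]⟩
  · exact ⟨p.1, (ratAbv _).pos (mod_cast p.2.ne_zero),
      (ratAbv_some_natCast_lt_one_iff p p.1).2 dvd_rfl⟩

lemma eq_of_ratAbv_isEquiv {q r : Option Nat.Primes} (h : (ratAbv q).IsEquiv (ratAbv r)) :
    q = r := by
  rcases q with _ | p <;> rcases r with _ | p'
  · rfl
  · have : Fact p'.1.Prime := ⟨p'.2⟩
    exact absurd h (Rat.AbsoluteValue.not_real_isEquiv_padic p'.1)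
  · have : Fact p.1.Prime := ⟨p.2⟩
    exact absurd h.symm (Rat.AbsoluteValue.not_real_isEquiv_padic p.1)
  · have hdvd : p'.1 ∣ p.1 := (ratAbv_some_natCast_lt_one_iff p' p.1).1 <|
      h.lt_one_iff.1 <| (ratAbv_some_natCast_lt_one_iff p p.1).2 dvd_rfl
    exact congrArg some (Subtype.ext ((Nat.prime_dvd_prime_iff_eq p'.2 p.2).1 hdvd).symm)

/-- The place `v` lies over the place `q` of `ℚ`. -/
def Over (v : Place K) (q : Option Nat.Primes) : Prop :=
  ∀ x : ℚ, v.abv (x : K) = ratAbv q x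

lemma exists_over (v : Place K) : ∃ q, v.Over q := by
  rcases v.normalized with h | ⟨p, hp, h⟩
  · exact ⟨none, h⟩
  · exact ⟨some ⟨p, hp.1⟩, h⟩

@[simp] lemma over_comap_iff {w : Place L} {q : Option Nat.Primes} (σ : K →+* L) :
    (comap σ w).Over q ↔ w.Over q := by
  simp only [Over, comap_abv_apply, map_ratCast]

lemma over_unique_of_isEquiv {v w : Place K} {q r : Option Nat.Primes} (hv : v.Over q)
    (hw : w.Over r) (h : v.abv.IsEquiv w.abv) : q = r :=
  eq_of_ratAbv_isEquiv fun x y => by simpa only [hv _, hw _] using h (x : K) (y : K)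

lemma Over.unique {v : Place K} {q r : Option Nat.Primes} (h : v.Over q) (h' : v.Over r) :
    q = r :=
  over_unique_of_isEquiv h h' .rfl

lemma exists_abv_lt_one (v : Place K) : ∃ a : ℚ, 0 < v.abv (a : K) ∧ v.abv (a : K) < 1 := by
  obtain ⟨q, hq⟩ := v.exists_over
  simpa only [hq _] using exists_ratAbv_lt_one q

lemma isNontrivial (v : Place K) : v.abv.IsNontrivial := by
  obtain ⟨a, h0, h1⟩ := v.exists_abv_lt_one
  exact ⟨a, v.abv.pos_iff.1 h0, h1.ne⟩

lemma eq_of_isEquiv {v w : Place K} (h : v.abv.IsEquiv w.abv) : v = w := by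
  obtain ⟨q, hv⟩ := v.exists_over
  obtain ⟨r, hw⟩ := w.exists_over
  obtain rfl := over_unique_of_isEquiv hv hw h
  obtain ⟨c, -, hc⟩ := AbsoluteValue.isEquiv_iff_exists_rpow_eq.1 h
  obtain ⟨a, h0, h1⟩ := exists_ratAbv_lt_one q
  have hc1 : c = 1 := by
    have ha : ratAbv q a ^ c = ratAbv q a ^ (1 : ℝ) := by
      simpa only [hv a, hw a, Real.rpow_one] using congrFun hc (a : K)
    exact (Real.rpow_right_inj h0 h1.ne).1 ha
  exact ext_abv fun x => by simpa only [hc1, Real.rpow_one] using congrFun hc x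

lemma Over.isNonarchimedean {v : Place K} {p : Nat.Primes} (hv : v.Over (some p)) :
    IsNonarchimedean v.abv := by
  let _ : NormedField K := v.abv.toNormedField
  have : IsUltrametricDist K := isUltrametricDist_iff_forall_norm_natCast_le_one.2 fun n => by
    have h := ratAbv_some_intCast_le_one p n
    rwa [← hv, Rat.cast_intCast, Int.cast_natCast] at h
  exact IsUltrametricDist.isNonarchimedean_norm

/-- The place of a field defined by an embedding into a normed field. -/
noncomputable def ofNormed {E : Type*} [NormedField E] (σ : K →+* E) {q : Option Nat.Primes}
    (h : ∀ x : ℚ, ‖(x : E)‖ = ratAbv q x) : Place K where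
  abv := (NormedField.toAbsoluteValue E).comp σ.injective
  normalized := by
    have hσ (x : ℚ) : (NormedField.toAbsoluteValue E).comp σ.injective (x : K) = ratAbv q x :=
      (congrArg norm (map_ratCast σ x)).trans (h x)
    rcases q with _ | p
    · exact .inl hσ
    · exact .inr ⟨p.1, ⟨p.2⟩, hσ⟩

lemma over_ofNormed {E : Type*} [NormedField E] (σ : K →+* E) {q : Option Nat.Primes}
    (h : ∀ x : ℚ, ‖(x : E)‖ = ratAbv q x) : (ofNormed σ h).Over q := fun x =>
  (congrArg norm (map_ratCast σ x)).trans (h x)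

lemma norm_ratCast_complex (x : ℚ) : ‖(x : ℂ)‖ = ratAbv none x := by
  simp [ratAbv_none]

lemma norm_ratCast_padicAlgCl (p : Nat.Primes) [Fact p.1.Prime] (x : ℚ) :
    ‖(x : PadicAlgCl p.1)‖ = ratAbv (some p) x := by
  rw [ratAbv_some, ← Padic.eq_padicNorm, ← PadicAlgCl.norm_extends, map_ratCast]

lemma exists_place_over (K : Type*) [Field K] [CharZero K] [Algebra.IsAlgebraic ℚ K]
    (q : Option Nat.Primes) : ∃ v : Place K, v.Over q := by
  rcases q with _ | p
  · exact ⟨_, over_ofNormed (IsAlgClosed.lift (R := ℚ) (S := K) (M := ℂ)).toRingHom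
      norm_ratCast_complex⟩
  · have : Fact p.1.Prime := ⟨p.2⟩
    exact ⟨_, over_ofNormed (IsAlgClosed.lift (R := ℚ) (S := K) (M := PadicAlgCl p.1)).toRingHom
      (norm_ratCast_padicAlgCl p)⟩

end Basic

end Place

instance : Algebra.IsAlgebraic ℚ Qbar := AlgebraicClosure.isAlgebraic ℚ

lemma norm_le_of_isRoot_of_norm_coeff_le {E : Type*} [NormedField E] {p : Polynomial E}
    (hp : p.Monic) {C : ℝ} (hC : 0 ≤ C) {a : E} (ha : p.IsRoot a) (h : ∀ i, ‖p.coeff i‖ ≤ C) :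
    ‖a‖ ≤ C + 1 := by
  lift C to NNReal using hC
  have hbound : p.cauchyBound ≤ C + 1 := by
    rw [Polynomial.cauchyBound, hp.leadingCoeff, nnnorm_one, div_one]
    gcongr
    exact Finset.sup_le fun i _ => h i
  exact_mod_cast (ha.norm_lt_cauchyBound hp.ne_zero).le.trans hbound

namespace Place

section Conjugation

open Polynomial NumberField

variable {L A : Type*} [Field L] [NumberField L] [Field A] [CharZero A] [IsAlgClosed A]

lemma abv_coeff_minpoly_le {y : Place A} {q : Option Nat.Primes} (hy : y.Over q) (x : L)
    (hx : ∀ σ : L →+* A, y.abv (σ x) ≤ 1) (i : ℕ) :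
    ratAbv q ((minpoly ℚ x).coeff i) ≤
      (Module.finrank ℚ L).choose (Module.finrank ℚ L / 2) := by
  let _ : NormedField A := y.abv.toNormedField
  have hroots : ∀ z ∈ ((minpoly ℚ x).map (algebraMap ℚ A)).roots, ‖z‖ ≤ 1 := fun z hz => by
    have hz' : z ∈ (minpoly ℚ x).rootSet A := by
      simpa [rootSet] using hz
    rw [← Embeddings.range_eval_eq_rootSet_minpoly] at hz'
    obtain ⟨σ, rfl⟩ := hz'
    exact hx σ
  have h := coeff_bdd_of_roots_le (algebraMap ℚ A)
    (minpoly.monic (Algebra.IsIntegral.isIntegral x)) (IsAlgClosed.splits _)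
    (minpoly.natDegree_le x) hroots i
  rw [coeff_map, eq_ratCast, max_self, one_pow, one_mul] at h
  exact (hy _).symm.trans_le h

lemma abv_le_of_forall_embedding_le_one {v : Place L} {y : Place A} {q : Option Nat.Primes}
    (hv : v.Over q) (hy : y.Over q) (x : L) (hx : ∀ σ : L →+* A, y.abv (σ x) ≤ 1) :
    v.abv x ≤ (Module.finrank ℚ L).choose (Module.finrank ℚ L / 2) + 1 := by
  let _ : NormedField L := v.abv.toNormedField
  have hmonic : ((minpoly ℚ x).map (algebraMap ℚ L)).Monic :=
    (minpoly.monic (Algebra.IsIntegral.isIntegral x)).map _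
  have hroot : ((minpoly ℚ x).map (algebraMap ℚ L)).IsRoot x := by
    rw [IsRoot.def, eval_map_algebraMap, minpoly.aeval]
  refine norm_le_of_isRoot_of_norm_coeff_le hmonic (Nat.cast_nonneg _) hroot fun i => ?_
  rw [coeff_map, eq_ratCast]
  exact (hv _).trans_le (abv_coeff_minpoly_le hy x hx i)

-- All powers of `x` obey the bound of the previous lemma.
lemma abv_le_one_of_forall_embedding_le_one {v : Place L} {y : Place A} {q : Option Nat.Primes}
    (hv : v.Over q) (hy : y.Over q) (x : L) (hx : ∀ σ : L →+* A, y.abv (σ x) ≤ 1) :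
    v.abv x ≤ 1 := by
  by_contra! h
  obtain ⟨n, hn⟩ := pow_unbounded_of_one_lt
    ((Module.finrank ℚ L).choose (Module.finrank ℚ L / 2) + 1 : ℝ) h
  refine hn.not_ge ?_
  rw [← map_pow]
  refine abv_le_of_forall_embedding_le_one hv hy _ fun σ => ?_
  rw [map_pow, map_pow]
  exact pow_le_one₀ (y.abv.nonneg _) (hx σ)

-- Otherwise weak approximation gives an `x` with `‖x‖_v > 1` all of whose conjugates are small.
theorem exists_comap_eq {v : Place L} {y : Place A} {q : Option Nat.Primes}
    (hv : v.Over q) (hy : y.Over q) : ∃ σ : L →+* A, comap σ y = v := by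
  classical
  by_contra! hne
  let T : Set (Place L) := insert v (Set.range fun σ : L →+* A => comap σ y)
  have : Finite T := (Set.finite_range _).insert v
  obtain ⟨x, hxv, hx⟩ := AbsoluteValue.exists_one_lt_lt_one_pi_of_not_isEquiv
    (v := fun w : T => w.1.abv) (fun w => w.1.isNontrivial)
    (fun w w' hww h => hww (Subtype.ext (eq_of_isEquiv h))) ⟨v, Set.mem_insert _ _⟩
  refine hxv.not_ge (abv_le_one_of_forall_embedding_le_one hv hy x fun σ => ?_)
  exact (hx ⟨comap σ y, Set.mem_insert_of_mem _ ⟨σ, rfl⟩⟩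
    fun h => hne σ (congrArg Subtype.val h)).le

lemma finite_over (q : Option Nat.Primes) : {v : Place L | v.Over q}.Finite := by
  obtain ⟨y, hy⟩ := exists_place_over Qbar q
  exact (Set.finite_range fun σ : L →+* Qbar => comap σ y).subset
    fun v hv => exists_comap_eq hv hy

instance : Countable (Place L) := by
  have hover : ⋃ q, {v : Place L | v.Over q} = Set.univ :=
    Set.eq_univ_of_forall fun v => Set.mem_iUnion.2 v.exists_over
  exact Set.countable_univ_iff.1 <| hover ▸ Set.countable_iUnion fun q => (finite_over q).countable

end Conjugation

end Place

lemma exists_ringEquiv_comp_eq {F A B : Type*} [Field F] [CharZero F] [Field A] [CharZero A]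
    [Field B] [CharZero B] [IsAlgClosed A] [IsAlgClosed B] [Algebra.IsAlgebraic ℚ A]
    [Algebra.IsAlgebraic ℚ B] (i : F →+* A) (j : F →+* B) :
    ∃ e : A ≃+* B, ∀ x, e (i x) = j x := by
  let _ := i.toAlgebra
  let _ := j.toAlgebra
  have : IsAlgClosure F A := ⟨inferInstance, .tower_top (K := ℚ) F⟩
  have : IsAlgClosure F B := ⟨inferInstance, .tower_top (K := ℚ) F⟩
  exact ⟨(IsAlgClosure.equiv F A B).toRingEquiv, (IsAlgClosure.equiv F A B).commutes⟩

lemma exists_algEquiv_comp_eq {F A : Type*} [Field F] [CharZero F] [Field A] [CharZero A]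
    [IsAlgClosed A] [Algebra.IsAlgebraic ℚ A] (i j : F →+* A) :
    ∃ τ : A ≃ₐ[ℚ] A, ∀ x, τ (i x) = j x :=
  let ⟨e, he⟩ := exists_ringEquiv_comp_eq i j
  ⟨AlgEquiv.ofRingEquiv (f := e) fun q => by simp, he⟩

lemma exists_algHom_comp_eq {F K A C : Type*} [Field F] [Field K] [Field A] [Field C]
    [Algebra F K] [Algebra F A] [Algebra F C] [Algebra.IsAlgebraic F K] [IsAlgClosed A]
    (j : A →ₐ[F] C) (g : K →ₐ[F] C) : ∃ σ : K →ₐ[F] A, j.comp σ = g := by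
  have hg (x : K) : g x ∈ j.range :=
    ((Algebra.IsIntegral.isIntegral x).map g).mem_range_algHom_of_minpoly_splits
      (IsAlgClosed.splits _) j
  refine ⟨(AlgEquiv.ofInjectiveField j).symm.toAlgHom.comp (g.codRestrict j.range hg), ?_⟩
  ext x
  exact congrArg Subtype.val ((AlgEquiv.ofInjectiveField j).apply_symm_apply ⟨g x, hg x⟩)

lemma splits_minpoly_of_isIntegral {k F E A C : Type*} [Field k] [Field F] [Field E] [Field A]
    [Field C] [Algebra k F] [Algebra k E] [Algebra F E] [IsScalarTower k F E] [Algebra k A]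
    [Algebra k C] [Algebra F C] [IsScalarTower k F C] [IsAlgClosed A] (j : A →ₐ[k] C) {x : E}
    (hx : IsIntegral k x) : ((minpoly F x).map (algebraMap F C)).Splits := by
  have hsplits : ((minpoly k x).map (algebraMap k C)).Splits := by
    rw [← j.comp_algebraMap, ← Polynomial.map_map]
    exact (IsAlgClosed.splits _).map _
  refine hsplits.of_dvd (Polynomial.map_ne_zero (minpoly.ne_zero hx)) ?_
  rw [IsScalarTower.algebraMap_eq k F C, ← Polynomial.map_map]
  exact Polynomial.map_dvd _ (minpoly.dvd_map_of_isScalarTower k F x)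

section DenseSubfield

variable {K F E : Type*} [Field K] [NumberField K] [NontriviallyNormedField F] [CompleteSpace F]
  [NormedField E] [NormedAlgebra F E] {ι : K →+* E}

lemma span_range_basis_eq_top (hι : DenseRange ι) {α : Type*} (b : Module.Basis α ℚ K) :
    Submodule.span F (Set.range fun i => ι (b i)) = ⊤ := by
  have : Finite α := Module.Finite.finite_basis b
  have hrange : Set.range ι ⊆ Submodule.span F (Set.range fun i => ι (b i)) := by
    rintro _ ⟨x, rfl⟩
    rw [← b.linearCombination_repr x, Finsupp.linearCombination_apply, Finsupp.sum, map_sum]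
    refine Submodule.sum_mem _ fun i _ => ?_
    rw [Rat.smul_def, map_mul, map_ratCast, ← map_ratCast (algebraMap F E), ← Algebra.smul_def]
    exact Submodule.smul_mem _ _ (Submodule.subset_span ⟨i, rfl⟩)
  have : FiniteDimensional F (Submodule.span F (Set.range fun i => ι (b i))) :=
    FiniteDimensional.span_of_finite _ (Set.finite_range _)
  have hclosed := Submodule.closed_of_finiteDimensional
    (Submodule.span F (Set.range fun i => ι (b i)))
  rw [← SetLike.coe_set_eq, Submodule.top_coe, ← hclosed.closure_eq]
  exact (hι.mono hrange).closure_eq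

lemma finiteDimensional_of_denseRange (hι : DenseRange ι) : FiniteDimensional F E :=
  .of_fg_top <| by
    rw [← span_range_basis_eq_top hι (Module.finBasis ℚ K)]
    exact Submodule.fg_span (Set.finite_range _)

lemma adjoin_powerBasis_gen_eq_top (hι : DenseRange ι) (pb : PowerBasis ℚ K) :
    Algebra.adjoin F {ι pb.gen} = ⊤ := by
  rw [← Algebra.toSubmodule_eq_top, eq_top_iff, ← span_range_basis_eq_top hι pb.basis,
    Submodule.span_le]
  rintro _ ⟨i, rfl⟩
  simp only [PowerBasis.coe_basis, map_pow]
  exact pow_mem (Algebra.subset_adjoin (Set.mem_singleton (ι pb.gen))) _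

lemma natCard_algHom_eq_finrank (hι : DenseRange ι) {A C : Type*} [Field A] [CharZero A]
    [IsAlgClosed A] [Field C] [Algebra F C] (j : A →+* C) :
    Nat.card (E →ₐ[F] C) = Module.finrank F E := by
  have : CharZero C := charZero_of_injective_ringHom j.injective
  have : CharZero E := charZero_of_injective_ringHom ι.injective
  have : CharZero F := (algebraMap F E).charZero_iff (algebraMap F E).injective |>.2 inferInstance
  have : FiniteDimensional F E := finiteDimensional_of_denseRange hι
  let α := Field.powerBasisOfFiniteOfSeparable ℚ K
  let pb := PowerBasis.ofAdjoinEqTop (Algebra.IsIntegral.isIntegral (R := F) (ι α.gen))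
    (adjoin_powerBasis_gen_eq_top hι α)
  have hgen : pb.gen = ι α.gen := PowerBasis.ofAdjoinEqTop_gen _ _
  have hint : IsIntegral ℚ pb.gen := by
    rw [hgen]
    exact (Algebra.IsIntegral.isIntegral α.gen).map ι.toRatAlgHom
  rw [AlgHom.natCard_of_powerBasis pb (Algebra.IsSeparable.isSeparable _ _)
    (splits_minpoly_of_isIntegral j.toRatAlgHom hint), pb.finrank]

end DenseSubfield

lemma norm_algHom_lt_one {F E C : Type*} [NontriviallyNormedField F] [CompleteSpace F]
    [NormedField E] [NormedAlgebra F E] [NormedField C] [NormedAlgebra F C]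
    [FiniteDimensional F E] (g : E →ₐ[F] C) {x : E} (hx : ‖x‖ < 1) : ‖g x‖ < 1 := by
  have hg : Continuous g := LinearMap.continuous_of_finiteDimensional g.toLinearMap
  have hlim : Filter.Tendsto (fun n : ℕ => ‖g x‖ ^ n) Filter.atTop (nhds 0) := by
    simpa [Function.comp_def] using
      ((hg.tendsto 0).comp (tendsto_pow_atTop_nhds_zero_of_norm_lt_one hx)).norm
  simpa using tendsto_pow_atTop_nhds_zero_iff.1 hlim

namespace Place

section Completion

open UniformSpace

variable {K A : Type*} [Field K] [CharZero K] [Field A] [CharZero A]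

/-- The canonical embedding of a field in its completion at a place. -/
noncomputable def toCompletion (v : Place K) : K →+* v.abv.Completion :=
  (Completion.coeRingHom (α := WithAbs v.abv)).comp (WithAbs.equiv v.abv).symm.toRingHom

lemma norm_toCompletion (v : Place K) (x : K) : ‖v.toCompletion x‖ = v.abv x :=
  Completion.norm_coe (WithAbs.toAbs v.abv x)

lemma denseRange_toCompletion (v : Place K) : DenseRange v.toCompletion :=
  Completion.denseRange_coe.comp (WithAbs.equiv v.abv).symm.surjective.denseRange
    (Completion.continuous_coe _)

variable {v : Place K} {y : Place A} {σ τ : K →+* A}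

lemma isometry_toCompletion_comp (h : comap σ y = v) :
    Isometry ((y.toCompletion.comp σ).comp (WithAbs.equiv v.abv).toRingHom) := by
  subst h
  exact AddMonoidHomClass.isometry_of_norm _ fun x => norm_toCompletion y _

/-- The extension to the completions of an embedding that is compatible with the places. -/
noncomputable def completionHom (h : comap σ y = v) : v.abv.Completion →+* y.abv.Completion :=
  Completion.extensionHom _ (isometry_toCompletion_comp h).continuous

lemma continuous_completionHom (h : comap σ y = v) : Continuous (completionHom h) :=
  Completion.continuous_extension

lemma norm_completionHom (h : comap σ y = v) (x : v.abv.Completion) : ‖completionHom h x‖ = ‖x‖ :=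
  AddMonoidHomClass.isometry_iff_norm _ |>.1 (isometry_toCompletion_comp h).completion_extension x

lemma completionHom_toCompletion (h : comap σ y = v) (x : K) :
    completionHom h (v.toCompletion x) = y.toCompletion (σ x) :=
  Completion.extensionHom_coe _ (isometry_toCompletion_comp h).continuous (WithAbs.toAbs v.abv x)

/-- The closure `ℚ_v` of `ℚ` in the completion, over which the local degree is taken. -/
noncomputable abbrev baseField (v : Place K) : Subfield v.abv.Completion :=
  (⊥ : Subfield v.abv.Completion).topologicalClosure

lemma completionHom_eq_on_baseField (hσ : comap σ y = v) (hτ : comap τ y = v) (x : v.baseField) :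
    completionHom hσ x = completionHom hτ x := by
  have hclosed : IsClosed {x | completionHom hσ x = completionHom hτ x} :=
    isClosed_eq (continuous_completionHom hσ) (continuous_completionHom hτ)
  have hbot : (⊥ : Subfield v.abv.Completion) ≤
      (completionHom hσ).eqLocusField (completionHom hτ) := bot_le
  exact closure_minimal hbot hclosed x.2

noncomputable instance (v : Place K) : NontriviallyNormedField v.baseField :=
  { (inferInstance : NormedField v.baseField) with
    non_trivial := by
      obtain ⟨a, h0, h1⟩ := v.exists_abv_lt_one
      have ha : ‖(a : v.baseField)‖ = v.abv (a : K) := by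
        rw [← norm_toCompletion, map_ratCast]
        rfl
      refine ⟨(a : v.baseField)⁻¹, ?_⟩
      rw [norm_inv, ha]
      exact (one_lt_inv₀ h0).2 h1 }

instance (v : Place K) : CompleteSpace v.baseField :=
  (Subfield.isClosed_topologicalClosure _).completeSpace_coe

noncomputable instance (v : Place K) : NormedAlgebra v.baseField v.abv.Completion where
  norm_smul_le _ _ := norm_mul_le _ _

lemma comap_eq_of_algHom {F E C : Type*} [NontriviallyNormedField F] [CompleteSpace F]
    [NormedField E] [NormedAlgebra F E] [FiniteDimensional F E] [NormedField C]
    [NormedAlgebra F C] {ι : K →+* E} (hι : ∀ x, ‖ι x‖ = v.abv x) {j : A →+* C}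
    (hj : ∀ x, ‖j x‖ = y.abv x) (g : E →ₐ[F] C) (hg : ∀ x, g (ι x) = j (σ x)) :
    comap σ y = v := by
  refine (eq_of_isEquiv <| AbsoluteValue.isEquiv_of_lt_one_imp v.isNontrivial fun x hx => ?_).symm
  rw [comap_abv_apply, ← hj, ← hg]
  exact norm_algHom_lt_one g (by rwa [hι])

/-- The structure of a normed `ℚ_v`-algebra on the completion at a place that induces `v`. -/
noncomputable abbrev normedAlgebraCompletion (h : comap σ y = v) :
    NormedAlgebra v.baseField y.abv.Completion :=
  { ((completionHom h).comp v.baseField.subtype).toAlgebra with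
    norm_smul_le r x := ((norm_mul _ _).trans (congrArg (· * ‖x‖) (norm_completionHom h r))).le }

end Completion

section LocalDegree

variable {K A : Type*} [Field K] [NumberField K] [Field A] [CharZero A]
  {v : Place K} {y : Place A}

theorem natCard_comap_eq_localDegree [IsAlgClosed A] {q : Option Nat.Primes} (hv : v.Over q)
    (hy : y.Over q) : Nat.card {σ : K →+* A // comap σ y = v} = v.localDegree := by
  obtain ⟨σ₀, hσ₀⟩ := exists_comap_eq hv hy
  let _ := normedAlgebraCompletion hσ₀
  have : FiniteDimensional v.baseField v.abv.Completion :=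
    finiteDimensional_of_denseRange v.denseRange_toCompletion
  let f (σ : {σ : K →+* A // comap σ y = v}) : v.abv.Completion →ₐ[v.baseField] y.abv.Completion :=
    { completionHom σ.2 with commutes' := completionHom_eq_on_baseField σ.2 hσ₀ }
  have hf (σ) (x : K) : f σ (v.toCompletion x) = y.toCompletion (σ.1 x) :=
    completionHom_toCompletion σ.2 x
  rw [localDegree, ← natCard_algHom_eq_finrank v.denseRange_toCompletion y.toCompletion]
  refine Nat.card_eq_of_bijective f ⟨fun σ τ h => ?_, fun g => ?_⟩
  · refine Subtype.ext (RingHom.ext fun x => y.toCompletion.injective ?_)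
    rw [← hf, ← hf, h]
  · obtain ⟨σ, hσ⟩ := exists_algHom_comp_eq y.toCompletion.toRatAlgHom
      ((g : v.abv.Completion →+* y.abv.Completion).comp v.toCompletion).toRatAlgHom
    have hgσ (x : K) : g (v.toCompletion x) = y.toCompletion (σ x) :=
      (DFunLike.congr_fun hσ x).symm
    have hcomap := comap_eq_of_algHom (norm_toCompletion v) (norm_toCompletion y) g hgσ
    have hg : Continuous g := LinearMap.continuous_of_finiteDimensional g.toLinearMap
    refine ⟨⟨σ, hcomap⟩, DFunLike.coe_injective <| v.denseRange_toCompletion.equalizer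
      (continuous_completionHom hcomap) hg (funext fun x => ?_)⟩
    exact (hf _ x).trans (hgσ x).symm

end LocalDegree

end Place

instance : IsAlgClosure ℚ Qbar := ⟨inferInstance, inferInstance⟩

instance : IsGalois ℚ Qbar where
  to_normal := IsAlgClosure.normal ℚ Qbar

lemma exists_galois_intermediateField {k : Type*} [Field k] [NumberField k] (i : k →+* Qbar) :
    ∃ l : IntermediateField ℚ Qbar, FiniteDimensional ℚ l ∧ IsGalois ℚ l ∧
      ∃ j : k →+* l, (algebraMap l Qbar).comp j = i := by
  let r := i.toRatAlgHom.fieldRange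
  have : FiniteDimensional ℚ r :=
    Module.Finite.of_surjective i.toRatAlgHom.rangeRestrict.toLinearMap
      i.toRatAlgHom.rangeRestrict_surjective
  let l := IntermediateField.normalClosure ℚ r Qbar
  have hr : r ≤ l := IntermediateField.le_normalClosure r
  refine ⟨l, inferInstance, ?_, i.codRestrict l.toSubfield fun x => hr ⟨x, rfl⟩, rfl⟩
  have : Normal ℚ l := by
    convert (normalClosure.normal ℚ r Qbar : @Normal ℚ l _ _ l.algebra')
    exact Subsingleton.elim _ _
  constructor

namespace Place

section Topology

variable {k l : Type*} [Field k] [CharZero k] [Algebra k Qbar] [Field l] [CharZero l]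
  [Algebra l Qbar]

lemma fiber_eq_iUnion_fiber (v : Place k) {j : k →+* l}
    (hj : (algebraMap l Qbar).comp j = algebraMap k Qbar) :
    v.fiber = ⋃ w ∈ {w : Place l | comap j w = v}, w.fiber := by
  ext y
  simp only [fiber, restrict_eq_comap, Set.mem_iUnion, Set.mem_ofPred_eq, exists_prop,
    exists_eq_right', comap_comap, hj]

lemma disjoint_fiber {v w : Place k} (h : v ≠ w) : Disjoint v.fiber w.fiber :=
  Set.disjoint_left.2 fun _ hv hw => h (hv.symm.trans hw)

lemma over_of_mem_fiber {v : Place k} {q : Option Nat.Primes} (hv : v.Over q) {y : Place Qbar}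
    (hy : y ∈ v.fiber) : y.Over q := by
  obtain rfl : y.restrict k = v := hy
  exact (over_comap_iff (algebraMap k Qbar)).1 hv

lemma isOpen_fiber {k : Type*} [Field k] [NumberField k] [Algebra k Qbar] (v : Place k) :
    IsOpen v.fiber := by
  obtain ⟨l, h1, h2, j, hj⟩ := exists_galois_intermediateField (algebraMap k Qbar)
  rw [fiber_eq_iUnion_fiber v hj]
  exact isOpen_biUnion fun w _ => TopologicalSpace.isOpen_generateFrom_of_mem ⟨l, h1, h2, w, rfl⟩

lemma measurableSet_fiber {k : Type*} [Field k] [NumberField k] [Algebra k Qbar] (v : Place k) :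
    MeasurableSet v.fiber :=
  v.isOpen_fiber.measurableSet

instance : T2Space (Place Qbar) := by
  refine ⟨fun y y' hne => ?_⟩
  obtain ⟨x, hx⟩ : ∃ x, y.abv x ≠ y'.abv x := by
    by_contra! h
    exact hne (ext_abv h)
  let k := IntermediateField.adjoin ℚ {x}
  have : FiniteDimensional ℚ k :=
    IntermediateField.adjoin.finiteDimensional (Algebra.IsIntegral.isIntegral x)
  have : NumberField k := ⟨⟩
  refine ⟨_, _, isOpen_fiber (y.restrict k), isOpen_fiber (y'.restrict k), rfl, rfl,
    disjoint_fiber fun h => hx ?_⟩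
  exact congrArg (fun w : Place k => w.abv ⟨x, IntermediateField.mem_adjoin_simple_self ℚ x⟩) h

lemma isOpen_over (q : Option Nat.Primes) : IsOpen {y : Place Qbar | y.Over q} := by
  obtain ⟨v, hv⟩ := exists_place_over ℚ q
  convert isOpen_fiber v using 1
  ext y
  exact ⟨fun hy => ext_abv fun x => (hy x).trans (hv x).symm, over_of_mem_fiber hv⟩

end Topology

section Galois

lemma isOpen_setOf_symm_comp {k : Type*} [Field k] [NumberField k] (i : k →+* Qbar)
    (s : Set (k →+* Qbar)) :
    IsOpen {τ : Qbar ≃ₐ[ℚ] Qbar | (τ.symm : Qbar →+* Qbar).comp i ∈ s} := by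
  rw [isOpen_iff_mem_nhds]
  intro τ hτ
  let r := i.toRatAlgHom.fieldRange
  have : FiniteDimensional ℚ r :=
    Module.Finite.of_surjective i.toRatAlgHom.rangeRestrict.toLinearMap
      i.toRatAlgHom.rangeRestrict_surjective
  have hopen : IsOpen ((fun τ' : Qbar ≃ₐ[ℚ] Qbar => τ * τ'⁻¹) ⁻¹'
      (r.fixingSubgroup : Set (Qbar ≃ₐ[ℚ] Qbar))) :=
    r.fixingSubgroup_isOpen.preimage (by fun_prop)
  refine Filter.mem_of_superset (hopen.mem_nhds (by simp)) fun τ' hτ' => ?_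
  have h : (τ'.symm : Qbar →+* Qbar).comp i = (τ.symm : Qbar →+* Qbar).comp i := by
    ext x
    have := (IntermediateField.mem_fixingSubgroup_iff _ _).1 hτ' (i x) ⟨x, rfl⟩
    exact (τ.symm_apply_eq.2 this.symm).symm
  simpa only [Set.mem_ofPred_eq, h] using hτ

lemma continuous_galois_left (y : Place Qbar) :
    Continuous fun τ : Qbar ≃ₐ[ℚ] Qbar => galois τ y := by
  refine continuous_generateFrom_iff.2 ?_
  rintro _ ⟨l, _, _, w, rfl⟩
  have : NumberField l := ⟨⟩
  exact isOpen_setOf_symm_comp (algebraMap l Qbar) {σ | comap σ y = w}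

lemma continuous_galois (τ : Qbar ≃ₐ[ℚ] Qbar) : Continuous (galois τ) := by
  refine continuous_generateFrom_iff.2 ?_
  rintro _ ⟨l, _, _, w, rfl⟩
  have : NumberField l := ⟨⟩
  let _ : Algebra l Qbar := ((τ.symm : Qbar →+* Qbar).comp (algebraMap l Qbar)).toAlgebra
  exact isOpen_fiber (k := l) w

lemma galois_galois (τ ρ : Qbar ≃ₐ[ℚ] Qbar) (y : Place Qbar) :
    galois τ (galois ρ y) = galois (τ * ρ) y := rfl

lemma image_galois_eq_preimage (τ : Qbar ≃ₐ[ℚ] Qbar) (E : Set (Place Qbar)) :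
    galois τ '' E = galois τ⁻¹ ⁻¹' E := by
  refine congrFun (Set.image_eq_preimage_of_inverse (fun y => ?_) (fun y => ?_)) E
  · rw [galois_galois, inv_mul_cancel]; rfl
  · rw [galois_galois, mul_inv_cancel]; rfl

lemma measurableSet_image_galois (τ : Qbar ≃ₐ[ℚ] Qbar) {E : Set (Place Qbar)}
    (hE : MeasurableSet E) : MeasurableSet (galois τ '' E) := by
  rw [image_galois_eq_preimage]
  exact (continuous_galois _).measurable hE

end Galois

section Haar

noncomputable local instance : MeasurableSpace (Qbar ≃ₐ[ℚ] Qbar) := borel (Qbar ≃ₐ[ℚ] Qbar)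

local instance : BorelSpace (Qbar ≃ₐ[ℚ] Qbar) := ⟨rfl⟩

/-- The Haar measure of total mass one on the absolute Galois group of `ℚ`. -/
noncomputable def galoisHaar : Measure (Qbar ≃ₐ[ℚ] Qbar) := Measure.haarMeasure ⊤

instance : galoisHaar.IsHaarMeasure := by unfold galoisHaar; infer_instance

instance : IsProbabilityMeasure galoisHaar :=
  ⟨Measure.haarMeasure_self (K₀ := (⊤ : TopologicalSpace.PositiveCompacts (Qbar ≃ₐ[ℚ] Qbar)))⟩

instance : galoisHaar.IsMulRightInvariant where
  map_mul_right_eq_self g := by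
    have : IsProbabilityMeasure (galoisHaar.map (· * g)) :=
      Measure.isProbabilityMeasure_map (measurable_mul_const g).aemeasurable
    exact Measure.isHaarMeasure_eq_of_isProbabilityMeasure _ _

variable {k : Type*} [Field k] [NumberField k]

lemma galoisHaar_symm_comp_eq (i σ σ' : k →+* Qbar) :
    galoisHaar {τ : Qbar ≃ₐ[ℚ] Qbar | (τ.symm : Qbar →+* Qbar).comp i = σ} =
      galoisHaar {τ : Qbar ≃ₐ[ℚ] Qbar | (τ.symm : Qbar →+* Qbar).comp i = σ'} := by
  obtain ⟨ρ, hρ⟩ := exists_algEquiv_comp_eq σ σ'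
  rw [← measure_preimage_mul_right galoisHaar ρ]
  congr 1
  ext τ
  have h (x : k) : ((τ * ρ).symm : Qbar →+* Qbar) (i x) = ρ.symm (τ.symm (i x)) := rfl
  simp only [Set.mem_ofPred_eq, Set.mem_preimage, RingHom.ext_iff, RingHom.comp_apply, h, ← hρ]
  exact forall_congr' fun x => ρ.symm_apply_eq

lemma galoisHaar_symm_comp_mem_eq_card_mul (i σ : k →+* Qbar) (t : Finset (k →+* Qbar)) :
    galoisHaar {τ : Qbar ≃ₐ[ℚ] Qbar | (τ.symm : Qbar →+* Qbar).comp i ∈ t} =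
      t.card * galoisHaar {τ : Qbar ≃ₐ[ℚ] Qbar | (τ.symm : Qbar →+* Qbar).comp i = σ} := by
  have hunion : {τ : Qbar ≃ₐ[ℚ] Qbar | (τ.symm : Qbar →+* Qbar).comp i ∈ t} =
      ⋃ σ' ∈ t, {τ : Qbar ≃ₐ[ℚ] Qbar | (τ.symm : Qbar →+* Qbar).comp i = σ'} := by
    ext τ; simp
  have hdisj : (t : Set (k →+* Qbar)).PairwiseDisjoint
      fun σ' => {τ : Qbar ≃ₐ[ℚ] Qbar | (τ.symm : Qbar →+* Qbar).comp i = σ'} :=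
    fun _ _ _ _ h => Set.disjoint_left.2 fun τ h1 h2 => h (h1.symm.trans h2)
  rw [hunion, measure_biUnion_finset hdisj
      fun σ' _ => (isOpen_setOf_symm_comp i {σ'}).measurableSet,
    Finset.sum_congr rfl fun σ' _ => galoisHaar_symm_comp_eq i σ' σ, Finset.sum_const,
    nsmul_eq_mul]

lemma galoisHaar_symm_comp_eq_inv_finrank (i σ : k →+* Qbar) :
    galoisHaar {τ : Qbar ≃ₐ[ℚ] Qbar | (τ.symm : Qbar →+* Qbar).comp i = σ} =
      (Module.finrank ℚ k : ℝ≥0∞)⁻¹ := by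
  have h := galoisHaar_symm_comp_mem_eq_card_mul i σ Finset.univ
  simp only [Finset.mem_univ, Set.ofPred_true, measure_univ, Finset.card_univ,
    NumberField.Embeddings.card] at h
  exact ENNReal.eq_inv_of_mul_eq_one_left (by rw [mul_comm, ← h])

lemma galoisHaar_symm_comp_mem (i : k →+* Qbar) (s : Set (k →+* Qbar)) :
    galoisHaar {τ : Qbar ≃ₐ[ℚ] Qbar | (τ.symm : Qbar →+* Qbar).comp i ∈ s} =
      (Nat.card s : ℝ≥0∞) / (Module.finrank ℚ k : ℝ≥0∞) := by
  have h := galoisHaar_symm_comp_mem_eq_card_mul i i s.toFinite.toFinset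
  simp only [Set.Finite.mem_toFinset] at h
  rw [h, galoisHaar_symm_comp_eq_inv_finrank, div_eq_mul_inv, Nat.card_eq_card_finite_toFinset]

/-- A place of `Qbar` over `q`, used as a base point of the Galois orbit of all such places. -/
noncomputable def basePoint (q : Option Nat.Primes) : Place Qbar :=
  (exists_place_over Qbar q).choose

lemma basePoint_over (q : Option Nat.Primes) : (basePoint q).Over q :=
  (exists_place_over Qbar q).choose_spec

/-- The Galois-invariant probability measure on the places over `q`: the image of Haar measure
under the orbit map. -/
noncomputable def orbitMeasure (q : Option Nat.Primes) : Measure (Place Qbar) :=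
  galoisHaar.map fun τ => galois τ (basePoint q)

lemma orbitMeasure_apply (q : Option Nat.Primes) {E : Set (Place Qbar)} (hE : MeasurableSet E) :
    orbitMeasure q E = galoisHaar {τ | galois τ (basePoint q) ∈ E} :=
  Measure.map_apply (continuous_galois_left _).measurable hE

instance (q : Option Nat.Primes) : (orbitMeasure q).InnerRegular :=
  Measure.InnerRegular.map_of_continuous (continuous_galois_left _)

instance (q : Option Nat.Primes) : IsProbabilityMeasure (orbitMeasure q) :=
  Measure.isProbabilityMeasure_map (continuous_galois_left _).measurable.aemeasurable

lemma orbitMeasure_eq_zero {q r : Option Nat.Primes} (h : q ≠ r) {E : Set (Place Qbar)}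
    (hE : MeasurableSet E) (hEr : ∀ y ∈ E, y.Over r) : orbitMeasure q E = 0 := by
  have hempty : {τ | galois τ (basePoint q) ∈ E} = ∅ := by
    refine Set.eq_empty_of_forall_notMem fun τ hτ => h ?_
    have hq : (galois τ (basePoint q)).Over q :=
      (over_comap_iff (τ.symm : Qbar →+* Qbar)).2 (basePoint_over q)
    exact hq.unique (hEr _ hτ)
  rw [orbitMeasure_apply q hE, hempty, measure_empty]

lemma orbitMeasure_fiber [Algebra k Qbar] {v : Place k} {q : Option Nat.Primes} (hv : v.Over q) :
    orbitMeasure q v.fiber = (v.localDegree : ℝ≥0∞) / (Module.finrank ℚ k : ℝ≥0∞) := by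
  rw [orbitMeasure_apply q v.measurableSet_fiber,
    ← natCard_comap_eq_localDegree hv (basePoint_over q)]
  exact galoisHaar_symm_comp_mem (algebraMap k Qbar) {σ | comap σ (basePoint q) = v}

lemma orbitMeasure_image (q : Option Nat.Primes) (τ : Qbar ≃ₐ[ℚ] Qbar) {E : Set (Place Qbar)}
    (hE : MeasurableSet E) : orbitMeasure q (galois τ '' E) = orbitMeasure q E := by
  rw [orbitMeasure_apply q (measurableSet_image_galois τ hE), orbitMeasure_apply q hE,
    image_galois_eq_preimage,
    ← measure_preimage_mul galoisHaar τ⁻¹ {ρ | galois ρ (basePoint q) ∈ E}]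
  rfl

lemma sum_orbitMeasure_apply {q : Option Nat.Primes} {E : Set (Place Qbar)}
    (hE : MeasurableSet E) (hEq : ∀ y ∈ E, y.Over q) :
    Measure.sum orbitMeasure E = orbitMeasure q E := by
  rw [Measure.sum_apply _ hE]
  exact tsum_eq_single q fun r hr => orbitMeasure_eq_zero hr hE hEq

lemma sum_orbitMeasure_fiber [Algebra k Qbar] (v : Place k) :
    Measure.sum orbitMeasure v.fiber =
      (v.localDegree : ℝ≥0∞) / (Module.finrank ℚ k : ℝ≥0∞) := by
  obtain ⟨q, hq⟩ := v.exists_over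
  rw [sum_orbitMeasure_apply v.measurableSet_fiber fun _ => over_of_mem_fiber hq,
    orbitMeasure_fiber hq]

lemma sum_orbitMeasure_over_lt_top (q : Option Nat.Primes) :
    Measure.sum orbitMeasure {y | y.Over q} < ∞ := by
  rw [sum_orbitMeasure_apply (isOpen_over q).measurableSet fun _ h => h]
  exact measure_lt_top _ _

instance : (Measure.sum orbitMeasure).OuterRegular := by
  obtain ⟨e, he⟩ := exists_surjective_nat (Option Nat.Primes)
  refine Measure.OuterRegular.of_restrict (s := fun n => {y | y.Over (e n)}) (fun n => ?_)
    (fun n => isOpen_over _) fun y _ => ?_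
  · have : IsFiniteMeasure ((Measure.sum orbitMeasure).restrict {y | y.Over (e n)}) :=
      ⟨by rw [Measure.restrict_apply_univ]; exact sum_orbitMeasure_over_lt_top _⟩
    infer_instance
  · obtain ⟨q, hq⟩ := y.exists_over
    obtain ⟨n, rfl⟩ := he q
    exact Set.mem_iUnion.2 ⟨n, hq⟩

instance : IsLocallyFiniteMeasure (Measure.sum orbitMeasure) where
  finiteAtNhds y :=
    let ⟨q, hq⟩ := y.exists_over
    ⟨_, (isOpen_over q).mem_nhds hq, sum_orbitMeasure_over_lt_top q⟩

theorem isNormalizedInvariant_sum_orbitMeasure :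
    IsNormalizedInvariant (Measure.sum orbitMeasure) where
  regular :=
    { innerRegular := Measure.InnerRegular.innerRegular.mono (fun _ hU => hU.measurableSet)
        fun _ h => h }
  invariant τ E hE := by
    rw [Measure.sum_apply _ hE, Measure.sum_apply _ (measurableSet_image_galois τ hE)]
    exact tsum_congr fun q => orbitMeasure_image q τ hE
  fiber l _ _ w :=
    have : NumberField l := ⟨⟩
    sum_orbitMeasure_fiber w

end Haar

section PlaceMeasure

variable {k : Type*} [Field k] [NumberField k] [Algebra k Qbar]

lemma measure_fiber_eq_of_isNormalizedInvariant {μ ν : Measure (Place Qbar)}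
    (hμ : IsNormalizedInvariant μ) (hν : IsNormalizedInvariant ν) (v : Place k) :
    μ v.fiber = ν v.fiber := by
  obtain ⟨l, h1, h2, j, hj⟩ := exists_galois_intermediateField (algebraMap k Qbar)
  have : NumberField l := ⟨⟩
  have hfin : {w : Place l | comap j w = v}.Finite := by
    obtain ⟨q, hq⟩ := v.exists_over
    exact (finite_over q).subset fun w hw => (over_comap_iff j).1 (hw ▸ hq)
  have hdisj : {w : Place l | comap j w = v}.PairwiseDisjoint fiber :=
    fun _ _ _ _ => disjoint_fiber
  rw [fiber_eq_iUnion_fiber v hj,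
    measure_biUnion hfin.countable hdisj fun w _ => w.measurableSet_fiber,
    measure_biUnion hfin.countable hdisj fun w _ => w.measurableSet_fiber]
  exact tsum_congr fun w => (hμ.fiber l h1 h2 w).trans (hν.fiber l h1 h2 w).symm

theorem isNormalizedInvariant_placeMeasure : IsNormalizedInvariant placeMeasure :=
  Classical.epsilon_spec ⟨_, isNormalizedInvariant_sum_orbitMeasure⟩

theorem placeMeasure_fiber (v : Place k) :
    placeMeasure v.fiber = (v.localDegree : ℝ≥0∞) / (Module.finrank ℚ k : ℝ≥0∞) := by
  rw [measure_fiber_eq_of_isNormalizedInvariant isNormalizedInvariant_placeMeasure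
    isNormalizedInvariant_sum_orbitMeasure, sum_orbitMeasure_fiber]

instance : SigmaFinite placeMeasure := by
  refine Measure.sigmaFinite_of_countable (S := Set.range fun v : Place ℚ => v.fiber)
    (Set.countable_range _) ?_ ?_
  · rintro _ ⟨v, rfl⟩
    exact (placeMeasure_fiber v).trans_lt (ENNReal.div_lt_top (by simp) (by simp))
  · exact Set.eq_univ_of_forall fun y => ⟨_, ⟨y.restrict ℚ, rfl⟩, rfl⟩

end PlaceMeasure

end Place

lemma exists_pow_eq_span_singleton {R : Type*} [CommRing R] [IsDedekindDomain R]
    [Finite (ClassGroup R)] {I : Ideal R} (hI : I ≠ ⊥) :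
    ∃ n ≠ 0, ∃ a : R, I ^ n = Ideal.span {a} := by
  have hI' : I ∈ nonZeroDivisors (Ideal R) := mem_nonZeroDivisors_of_ne_zero hI
  have hprincipal : ClassGroup.mk0 (⟨I, hI'⟩ ^ Nat.card (ClassGroup R)) = 1 := by
    rw [map_pow, pow_card_eq_one']
  exact ⟨_, Nat.card_ne_zero.2 ⟨⟨1⟩, inferInstance⟩,
    ((ClassGroup.mk0_eq_one_iff (pow_mem hI' _)).1 hprincipal).principal⟩

section Center

open IsDedekindDomain

variable {R K Γ : Type*} [CommRing R] [Field K] [Algebra R K] [LinearOrderedCommGroupWithZero Γ]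

/-- The centre on `R` of a valuation of a field `K` containing `R` that is at most `1` on `R`. -/
def valuationCenter (w : Valuation K Γ) (hR : ∀ r : R, w (algebraMap R K r) ≤ 1) : Ideal R :=
  (IsLocalRing.maximalIdeal w.valuationSubring).comap
    ((algebraMap R K).codRestrict w.valuationSubring.toSubring hR)

lemma mem_valuationCenter {w : Valuation K Γ} {hR : ∀ r : R, w (algebraMap R K r) ≤ 1} {r : R} :
    r ∈ valuationCenter w hR ↔ w (algebraMap R K r) < 1 :=
  Valuation.mem_maximalIdeal_iff K w

variable [IsDedekindDomain R] [IsFractionRing R K]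

-- The valuation ring of a prime `P` has Krull dimension one, so it is not properly contained in the
-- ring of any other nontrivial valuation.
lemma exists_isEquiv_valuation (w : Valuation K Γ) [w.IsNontrivial]
    (hR : ∀ r : R, w (algebraMap R K r) ≤ 1) :
    ∃ P : HeightOneSpectrum R, w.IsEquiv (P.valuation K) := by
  have hprime : (valuationCenter w hR).IsPrime := Ideal.comap_isPrime _ _
  have hbot : valuationCenter w hR ≠ ⊥ := by
    obtain ⟨x, hx0, hx⟩ := Valuation.IsNontrivial.exists_lt_one (v := w)
    obtain ⟨a, b, hb, rfl⟩ := IsFractionRing.div_surjective R x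
    have ha : a ≠ 0 := by
      rintro rfl
      simp at hx0
    refine fun h => ha ((Ideal.mem_bot (R := R)).1 (h ▸ mem_valuationCenter.2 ?_))
    rw [map_div₀] at hx
    have hwb : w (algebraMap R K b) ≠ 0 := by simpa using nonZeroDivisors.ne_zero hb
    exact ((div_lt_one₀ (zero_lt_iff.2 hwb)).1 hx).trans_le (hR b)
  let P : HeightOneSpectrum R := ⟨valuationCenter w hR, hprime, hbot⟩
  have hle : (P.valuation K).valuationSubring ≤ w.valuationSubring := by
    intro x hx
    obtain ⟨n, d, h⟩ := P.exists_primeCompl_mul_eq_of_integer x hx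
    have hd : w (algebraMap R K d) = 1 :=
      (hR d).antisymm (not_lt.1 fun hlt => d.2 (mem_valuationCenter.2 hlt))
    have hwx : w x * w (algebraMap R K d) ≤ 1 := by
      rw [← map_mul, h]
      exact hR n
    rwa [hd, mul_one] at hwx
  refine ⟨P, (Valuation.isEquiv_iff_valuationSubring _ _).2
    (ValuationSubring.eq_of_le_of_ne_top _ hle ?_).symm⟩
  rwa [Ne, Valuation.valuationSubring_eq_top_iff, not_not]

end Center

section Power

variable {K : Type*} [Field K]

/-- The power `f ^ c` of a non-archimedean absolute value, for an exponent `c > 0`. -/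
noncomputable def nonarchimedeanRpow {f : AbsoluteValue K ℝ} (hf : IsNonarchimedean f) {c : ℝ}
    (hc : 0 < c) : AbsoluteValue K ℝ where
  toFun x := f x ^ c
  map_mul' x y := by rw [map_mul, Real.mul_rpow (f.nonneg x) (f.nonneg y)]
  nonneg' x := Real.rpow_nonneg (f.nonneg x) c
  eq_zero' x := by rw [Real.rpow_eq_zero (f.nonneg x) hc.ne', f.eq_zero]
  add_le' x y := by
    have hmax : f (x + y) ^ c ≤ max (f x) (f y) ^ c :=
      Real.rpow_le_rpow (f.nonneg _) (hf x y) hc.le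
    rcases max_choice (f x) (f y) with h | h <;> rw [h] at hmax
    · exact hmax.trans (le_add_of_nonneg_right (Real.rpow_nonneg (f.nonneg y) c))
    · exact hmax.trans (le_add_of_nonneg_left (Real.rpow_nonneg (f.nonneg x) c))

lemma isEquiv_nonarchimedeanRpow {f : AbsoluteValue K ℝ} (hf : IsNonarchimedean f) {c : ℝ}
    (hc : 0 < c) : f.IsEquiv (nonarchimedeanRpow hf hc) :=
  AbsoluteValue.isEquiv_iff_exists_rpow_eq.2 ⟨c, hc, rfl⟩

end Power

namespace Place

section Finite

open scoped NNReal
open NumberField IsDedekindDomain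

variable {K : Type*} [Field K] [CharZero K]

lemma exists_over_some {v : Place K} (hv : ¬ v.IsArchimedean) :
    ∃ p : Nat.Primes, v.Over (some p) := by
  obtain ⟨_ | p, h⟩ := v.exists_over
  exacts [absurd h hv, ⟨p, h⟩]

lemma isNonarchimedean {v : Place K} (hv : ¬ v.IsArchimedean) : IsNonarchimedean v.abv :=
  let ⟨_, hp⟩ := exists_over_some hv
  hp.isNonarchimedean

-- Ostrowski: a suitable power of the absolute value is normalized.
lemma exists_isEquiv_of_isNonarchimedean {f : AbsoluteValue K ℝ} (hf : IsNonarchimedean f)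
    (hnt : ∃ x : ℚ, x ≠ 0 ∧ f (x : K) ≠ 1) :
    ∃ v : Place K, ¬ v.IsArchimedean ∧ v.abv.IsEquiv f := by
  let fQ : AbsoluteValue ℚ ℝ := f.comp (algebraMap ℚ K).injective
  have hfQ (x : ℚ) : fQ x = f (x : K) := congrArg f (eq_ratCast (algebraMap ℚ K) x)
  obtain ⟨p, ⟨hp, hequiv⟩, -⟩ := Rat.AbsoluteValue.equiv_padic_of_bounded (f := fQ)
    (by simpa only [AbsoluteValue.IsNontrivial, hfQ] using hnt)
    fun n => by simpa only [hfQ, Rat.cast_natCast] using hf.apply_natCast_le_one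
  obtain ⟨c, hc, hpow⟩ := AbsoluteValue.isEquiv_iff_exists_rpow_eq.1 hequiv
  have hpadic (x : ℚ) : nonarchimedeanRpow hf hc (x : K) = Rat.AbsoluteValue.padic p x :=
    (congrArg (· ^ c) (hfQ x)).symm.trans (congrFun hpow x)
  let v : Place K := ⟨nonarchimedeanRpow hf hc, .inr ⟨p, hp, hpadic⟩⟩
  have hv : v.Over (some ⟨p, hp.1⟩) := hpadic
  exact ⟨v, fun h => Option.some_ne_none _ (hv.unique h), (isEquiv_nonarchimedeanRpow hf hc).symm⟩

/-- A finite place as a valuation. -/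
def valuation (v : Place K) (hv : ¬ v.IsArchimedean) : Valuation K ℝ≥0 where
  toFun x := ⟨v.abv x, v.abv.nonneg x⟩
  map_zero' := NNReal.eq v.abv.map_zero
  map_one' := NNReal.eq v.abv.map_one
  map_mul' x y := NNReal.eq (v.abv.map_mul x y)
  map_add_le_max' := isNonarchimedean hv

lemma valuation_lt_one_iff {v : Place K} (hv : ¬ v.IsArchimedean) {x : K} :
    v.valuation hv x < 1 ↔ v.abv x < 1 := .rfl

lemma valuation_eq_one_iff {v : Place K} (hv : ¬ v.IsArchimedean) {x : K} :
    v.valuation hv x = 1 ↔ v.abv x = 1 :=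
  NNReal.eq_iff

lemma valuation_le_one_of_isIntegral {v : Place K} (hv : ¬ v.IsArchimedean) {x : K}
    (hx : IsIntegral ℤ x) : v.valuation hv x ≤ 1 :=
  (Valuation.integer.integers (v.valuation hv)).mem_of_integral hx.tower_top

lemma isNontrivial_valuation {v : Place K} (hv : ¬ v.IsArchimedean) :
    (v.valuation hv).IsNontrivial := by
  obtain ⟨a, h0, h1⟩ := v.exists_abv_lt_one
  exact (Valuation.isNontrivial_iff_exists_lt_one _).2 ⟨a, v.abv.pos_iff.1 h0, h1⟩

variable {k : Type*} [Field k] [NumberField k]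

lemma exists_valuation_isEquiv {v : Place k} (hv : ¬ v.IsArchimedean) :
    ∃ P : HeightOneSpectrum (𝓞 k), (v.valuation hv).IsEquiv (P.valuation k) :=
  have := isNontrivial_valuation hv
  exists_isEquiv_valuation _ fun x => valuation_le_one_of_isIntegral hv x.isIntegral_coe

/-- The prime ideal of `𝓞 k` that corresponds to a finite place of `k`. -/
noncomputable def prime (v : Place k) (hv : ¬ v.IsArchimedean) : HeightOneSpectrum (𝓞 k) :=
  (exists_valuation_isEquiv hv).choose

lemma valuation_isEquiv {v : Place k} (hv : ¬ v.IsArchimedean) :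
    (v.valuation hv).IsEquiv ((v.prime hv).valuation k) :=
  (exists_valuation_isEquiv hv).choose_spec

lemma prime_injective {v w : Place k} {hv : ¬ v.IsArchimedean} {hw : ¬ w.IsArchimedean}
    (h : v.prime hv = w.prime hw) : v = w :=
  eq_of_isEquiv <| AbsoluteValue.isEquiv_iff_lt_one_iff.2 fun _ =>
    Valuation.isEquiv_iff_val_lt_one.1
      ((valuation_isEquiv hv).trans (h ▸ (valuation_isEquiv hw).symm))

lemma exists_prime_eq (P : HeightOneSpectrum (𝓞 k)) :
    ∃ (v : Place k) (hv : ¬ v.IsArchimedean), v.prime hv = P := by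
  have hlt {x : k} : HeightOneSpectrum.adicAbv k P x < 1 ↔ P.valuation k x < 1 := by
    rw [HeightOneSpectrum.adicAbv_def, ← NNReal.coe_one, NNReal.coe_lt_coe]
    exact WithZeroMulInt.toNNReal_lt_one_iff (HeightOneSpectrum.one_lt_absNorm_nnreal P)
  have hmem : P.valuation k ((Ideal.absNorm P.asIdeal : ℚ) : k) < 1 := by
    have h := (HeightOneSpectrum.valuation_lt_one_iff_mem (K := k) P _).2
      (Ideal.absNorm_mem P.asIdeal)
    simpa using h
  obtain ⟨v, hv, hequiv⟩ := exists_isEquiv_of_isNonarchimedean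
    (HeightOneSpectrum.isNonarchimedean_adicAbv k P)
    ⟨Ideal.absNorm P.asIdeal, mod_cast HeightOneSpectrum.absNorm_ne_zero P, (hlt.2 hmem).ne⟩
  refine ⟨v, hv, HeightOneSpectrum.eq_of_valuation_isEquiv_valuation (K := k) <|
    (valuation_isEquiv hv).symm.trans <| Valuation.isEquiv_iff_val_lt_one.2 fun {x} => ?_⟩
  exact hequiv.lt_one_iff.trans hlt

/-- The order of a unit of `k` at a finite place, with values in the multiplicative group `ℤ`. -/
noncomputable def ord (v : Place k) (hv : ¬ v.IsArchimedean) : kˣ →* Multiplicative ℤ :=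
  (v.prime hv).valuationOfNeZero

lemma ord_eq_one_iff {v : Place k} (hv : ¬ v.IsArchimedean) {u : kˣ} :
    v.ord hv u = 1 ↔ v.abv (u : k) = 1 := by
  rw [← valuation_eq_one_iff hv, (valuation_isEquiv hv).eq_one_iff_eq_one,
    ← HeightOneSpectrum.valuationOfNeZero_eq, ← WithZero.coe_one, WithZero.coe_inj]
  rfl

lemma abv_unit_eq_one {v : Place k} (hv : ¬ v.IsArchimedean) (u : (𝓞 k)ˣ) :
    v.abv ((u : 𝓞 k) : k) = 1 :=
  (ord_eq_one_iff hv (u := Units.map (algebraMap (𝓞 k) k : 𝓞 k →* k) u)).1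
    (HeightOneSpectrum.valuation_of_unit_eq _ u)

lemma isIntegral_of_abv_le_one {x : k} (h : ∀ v : Place k, ¬ v.IsArchimedean → v.abv x ≤ 1) :
    IsIntegral ℤ x := by
  obtain ⟨a, rfl⟩ := HeightOneSpectrum.mem_integers_of_valuation_le_one (R := 𝓞 k) k x fun P => by
    obtain ⟨v, hv, rfl⟩ := exists_prime_eq P
    exact (valuation_isEquiv hv).le_one_iff_le_one.1 (h v hv)
  exact a.isIntegral_coe

lemma abv_lt_one_iff_mem_prime {v : Place k} (hv : ¬ v.IsArchimedean) {a : 𝓞 k} :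
    v.abv (a : k) < 1 ↔ a ∈ (v.prime hv).asIdeal := by
  rw [← valuation_lt_one_iff hv, (valuation_isEquiv hv).lt_one_iff_lt_one]
  exact HeightOneSpectrum.valuation_lt_one_iff_mem _ a

lemma exists_unit_abv_eq_one_iff_ne {v : Place k} (hv : ¬ v.IsArchimedean) :
    ∃ a : kˣ, ∀ w : Place k, ¬ w.IsArchimedean → (w.abv (a : k) = 1 ↔ w ≠ v) := by
  obtain ⟨n, hn, a, ha⟩ := exists_pow_eq_span_singleton (v.prime hv).ne_bot
  have ha0 : a ≠ 0 := by
    rintro rfl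
    exact pow_ne_zero n (v.prime hv).ne_bot (ha.trans Ideal.span_zero)
  refine ⟨Units.mk0 (a : k) (by simpa using ha0), fun w hw => ?_⟩
  have hmem : a ∈ (w.prime hw).asIdeal ↔ w = v := by
    rw [← Ideal.span_singleton_le_iff_mem, ← ha, (w.prime hw).isPrime.pow_le_iff hn]
    refine ⟨fun h => ?_, ?_⟩
    · exact (prime_injective (HeightOneSpectrum.ext
        ((v.prime hv).isMaximal.eq_of_le (w.prime hw).isPrime.ne_top h))).symm
    · rintro rfl
      exact le_rfl
  rw [Units.val_mk0, ne_eq, ← hmem, ← abv_lt_one_iff_mem_prime, not_lt]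
  exact (show w.abv (a : k) ≤ 1 from
    valuation_le_one_of_isIntegral hw a.isIntegral_coe).ge_iff_eq.symm

lemma natCard_isArchimedean :
    Nat.card {v : Place k // v.IsArchimedean} = Fintype.card (InfinitePlace k) := by
  have hover (w : InfinitePlace k) (q : ℚ) : w.1 (q : k) = ratAbv none q := by
    obtain ⟨_, σ, rfl⟩ := w
    exact over_ofNormed σ norm_ratCast_complex q
  rw [← Nat.card_eq_fintype_card]
  refine (Nat.card_eq_of_bijective (fun w : InfinitePlace k =>
    (⟨⟨w.1, .inl (hover w)⟩, hover w⟩ : {v : Place k // v.IsArchimedean})) ⟨?_, ?_⟩).symm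
  · exact fun w w' h => Subtype.ext (congrArg (fun v => v.1.abv) h)
  · rintro ⟨v, hv⟩
    obtain ⟨σ, rfl⟩ := exists_comap_eq (q := none) hv
      (over_ofNormed (RingHom.id ℂ) norm_ratCast_complex)
    exact ⟨InfinitePlace.mk σ, rfl⟩

end Finite

end Place

lemma finrank_eq_natCard_of_forall_exists_single_mem {R ι : Type*} [CommRing R] [IsDomain R]
    [IsNoetherianRing R] [Finite ι] [DecidableEq ι] {N : Submodule R (ι → R)}
    (h : ∀ i, ∃ r ≠ 0, Pi.single i r ∈ N) : Module.finrank R N = Nat.card ι := by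
  have := Fintype.ofFinite ι
  choose r hr hmem using h
  have hli : LinearIndependent R fun i => (⟨Pi.single i (r i), hmem i⟩ : N) := by
    refine LinearIndependent.of_comp N.subtype (Fintype.linearIndependent_iff.2 fun g hg i => ?_)
    simpa [Finset.sum_apply, Pi.single_apply, hr i] using congrFun hg i
  rw [Nat.card_eq_fintype_card]
  exact ((Submodule.finrank_le N).trans (Module.finrank_fintype_fun_eq_card R).le).antisymm
    hli.fintype_card_le_finrank

section Rank

open NumberField Place

variable {k : Type*} [Field k] [NumberField k]

/-- The finite places in `S`. -/
abbrev FinitePlacesIn (S : Finset (Place k)) : Type _ := {v : S // ¬ v.1.IsArchimedean}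

/-- The orders of `S`-units at the finite places in `S`. -/
noncomputable def sUnitsOrd (S : Finset (Place k)) :
    Additive (sUnits S) →ₗ[ℤ] (FinitePlacesIn S → ℤ) :=
  LinearMap.pi fun v => (AddMonoidHom.toMultiplicativeRight.symm
    ((v.1.1.ord v.2).comp (sUnits S).subtype)).toIntLinearMap

variable {S : Finset (Place k)}

lemma sUnitsOrd_apply_eq_zero_iff {u : Additive (sUnits S)} {v : FinitePlacesIn S} :
    sUnitsOrd S u v = 0 ↔ v.1.1.abv ((u.toMul : kˣ) : k) = 1 :=
  ord_eq_one_iff v.2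

/-- The units of the ring of integers as `S`-units. -/
noncomputable def unitsToSUnits (hS : ∀ v : Place k, v.IsArchimedean → v ∈ S) :
    Additive (𝓞 k)ˣ →ₗ[ℤ] Additive (sUnits S) :=
  (MonoidHom.toAdditive ((Units.map (algebraMap (𝓞 k) k : 𝓞 k →* k)).codRestrict (sUnits S)
    fun u v hv => abv_unit_eq_one (fun h => hv (hS v h)) u)).toIntLinearMap

lemma unitsToSUnits_injective (hS : ∀ v : Place k, v.IsArchimedean → v ∈ S) :
    Function.Injective (unitsToSUnits hS) := fun _ _ h =>
  Units.map_injective RingOfIntegers.coe_injective (congrArg (fun x => (x.toMul : kˣ)) h)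

lemma range_unitsToSUnits (hS : ∀ v : Place k, v.IsArchimedean → v ∈ S) :
    LinearMap.range (unitsToSUnits hS) = LinearMap.ker (sUnitsOrd S) := by
  ext u
  rw [LinearMap.mem_range, LinearMap.mem_ker]
  constructor
  · rintro ⟨u, rfl⟩
    exact funext fun v => sUnitsOrd_apply_eq_zero_iff.2 (abv_unit_eq_one v.2 u.toMul)
  · intro h
    have habv (v : Place k) (hv : ¬ v.IsArchimedean) : v.abv ((u.toMul : kˣ) : k) = 1 := by
      by_cases hvS : v ∈ S
      · exact sUnitsOrd_apply_eq_zero_iff.1 (congrFun h ⟨⟨v, hvS⟩, hv⟩)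
      · exact u.toMul.2 v hvS
    let a : 𝓞 k := ⟨((u.toMul : kˣ) : k), isIntegral_of_abv_le_one fun v hv => (habv v hv).le⟩
    let b : 𝓞 k := ⟨((u.toMul : kˣ) : k)⁻¹, isIntegral_of_abv_le_one fun v hv => by
      rw [map_inv₀, habv v hv, inv_one]⟩
    have hab : a * b = 1 := RingOfIntegers.ext (mul_inv_cancel₀ (u.toMul : kˣ).ne_zero)
    exact ⟨Additive.ofMul ⟨a, b, hab, by rw [mul_comm, hab]⟩,
      congrArg Additive.ofMul (Subtype.ext (Units.ext rfl))⟩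

lemma finite_sUnits (hS : ∀ v : Place k, v.IsArchimedean → v ∈ S) :
    Module.Finite ℤ (Additive (sUnits S)) := by
  rw [Module.finite_def]
  refine Submodule.fg_of_fg_map_of_fg_inf_ker (sUnitsOrd S) (IsNoetherian.noetherian _) ?_
  rw [inf_of_le_right le_top, ← range_unitsToSUnits hS, ← Module.Finite.iff_fg]
  infer_instance

lemma exists_single_mem_range_sUnitsOrd [DecidableEq (FinitePlacesIn S)]
    (hS : ∀ v : Place k, v.IsArchimedean → v ∈ S) (v : FinitePlacesIn S) :
    ∃ n ≠ 0, Pi.single v n ∈ LinearMap.range (sUnitsOrd S) := by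
  obtain ⟨a, ha⟩ := exists_unit_abv_eq_one_iff_ne v.2
  have haS : a ∈ sUnits S := fun w hw =>
    (ha w fun h => hw (hS w h)).2 fun h => hw (h ▸ v.1.2)
  have hord (w : FinitePlacesIn S) : sUnitsOrd S (Additive.ofMul ⟨a, haS⟩) w = 0 ↔ w ≠ v :=
    sUnitsOrd_apply_eq_zero_iff.trans ((ha w.1 w.2).trans
      (Subtype.val_injective.comp Subtype.val_injective).ne_iff)
  refine ⟨_, fun h => (hord v).1 h rfl, Additive.ofMul ⟨a, haS⟩, funext fun w => ?_⟩
  rcases eq_or_ne w v with rfl | hne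
  · rw [Pi.single_eq_same]
  · rw [Pi.single_eq_of_ne hne, (hord w).2 hne]

lemma finrank_sUnits (hS : ∀ v : Place k, v.IsArchimedean → v ∈ S) :
    Module.finrank ℤ (Additive (sUnits S)) = S.card - 1 := by
  classical
  have := finite_sUnits hS
  have hcard : Fintype.card (InfinitePlace k) + Nat.card (FinitePlacesIn S) = S.card := by
    rw [← natCard_isArchimedean, ← Nat.card_congr (Equiv.subtypeSubtypeEquivSubtype (hS _)),
      ← Nat.card_sum, Nat.card_congr (Equiv.sumCompl _), Nat.card_eq_fintype_card,
      Fintype.card_coe]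
  have hpos : 0 < Fintype.card (InfinitePlace k) := Fintype.card_pos
  rw [← Submodule.finrank_quotient_add_finrank (LinearMap.ker (sUnitsOrd S)),
    (sUnitsOrd S).quotKerEquivRange.finrank_eq,
    finrank_eq_natCard_of_forall_exists_single_mem (exists_single_mem_range_sUnitsOrd hS),
    ← range_unitsToSUnits hS, LinearMap.finrank_range_of_inj (unitsToSUnits_injective hS),
    NumberField.Units.finrank_eq, NumberField.Units.rank]
  lia

lemma finite_sUnits_quotient_torsion (hS : ∀ v : Place k, v.IsArchimedean → v ∈ S) :
    Module.Finite ℤ (Additive (sUnits S ⧸ CommGroup.torsion (sUnits S))) := by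
  have := finite_sUnits hS
  exact Module.Finite.of_surjective
    (MonoidHom.toAdditive (QuotientGroup.mk' (CommGroup.torsion (sUnits S)))).toIntLinearMap
    (QuotientGroup.mk'_surjective (CommGroup.torsion (sUnits S)))

lemma finrank_sUnits_quotient_torsion (hS : ∀ v : Place k, v.IsArchimedean → v ∈ S) :
    Module.finrank ℤ (Additive (sUnits S ⧸ CommGroup.torsion (sUnits S))) = S.card - 1 := by
  rw [← finrank_sUnits hS]
  simpa using! finrank_quotient_torsion_eq (M := Additive (sUnits S))

end Rank

namespace Place

section ProductFormula

open Filter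

lemma eventually_prod_ratAbv_prime (p : Nat.Primes) :
    ∀ᶠ Q : Finset (Option Nat.Primes) in atTop, ∏ q ∈ Q, ratAbv q (p : ℚ) = 1 := by
  classical
  have := Fact.mk p.2
  filter_upwards [eventually_ge_atTop {none, some p}] with Q hQ
  rw [← Finset.prod_subset hQ, Finset.prod_pair (Option.some_ne_none p).symm, ratAbv_none,
    ratAbv_some, padicNorm.padicNorm_p_of_prime]
  · simp [p.2.ne_zero]
  · rintro (_ | q) _ hne
    · simp at hne
    · have := Fact.mk q.2
      have hqp : q.1 ≠ p.1 := fun h => by simp [Subtype.ext h] at hne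
      rw [ratAbv_some, padicNorm.padicNorm_of_prime_of_ne hqp, Rat.cast_one]

lemma eventually_prod_ratAbv_natCast {n : ℕ} (hn : n ≠ 0) :
    ∀ᶠ Q : Finset (Option Nat.Primes) in atTop, ∏ q ∈ Q, ratAbv q (n : ℚ) = 1 := by
  induction n using Nat.recOnMul with
  | zero => exact absurd rfl hn
  | one => simp
  | prime p hp => exact eventually_prod_ratAbv_prime ⟨p, hp⟩
  | mul a b ha hb =>
    filter_upwards [ha (left_ne_zero_of_mul hn), hb (right_ne_zero_of_mul hn)] with Q hQa hQb
    simp only [Nat.cast_mul, map_mul, Finset.prod_mul_distrib, hQa, hQb, mul_one]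

lemma eventually_prod_ratAbv {r : ℚ} (hr : r ≠ 0) :
    ∀ᶠ Q : Finset (Option Nat.Primes) in atTop, ∏ q ∈ Q, ratAbv q r = 1 := by
  filter_upwards [eventually_prod_ratAbv_natCast (Int.natAbs_ne_zero.2 (Rat.num_ne_zero.2 hr)),
    eventually_prod_ratAbv_natCast r.den_ne_zero] with Q hnum hden
  simp only [AbsoluteValue.apply_natAbs_eq] at hnum
  rw [← Rat.num_div_den r]
  simp only [map_div₀, Finset.prod_div_distrib, hnum, hden, div_one]

variable {k : Type*} [Field k] [NumberField k]

lemma prod_abv_pow_localDegree_over {q : Option Nat.Primes} {T : Finset (Place k)}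
    (hT : ∀ v, v ∈ T ↔ v.Over q) (x : k) :
    ∏ v ∈ T, v.abv x ^ v.localDegree = ratAbv q (Algebra.norm ℚ x) := by
  classical
  have hy := basePoint_over q
  have hnorm : ((Algebra.norm ℚ x : ℚ) : Qbar) = ∏ σ : k →+* Qbar, σ x := by
    rw [← eq_ratCast (algebraMap ℚ Qbar), Algebra.norm_eq_prod_embeddings ℚ Qbar x]
    exact Fintype.prod_equiv (RingHom.equivRatAlgHom k Qbar).symm _ _ fun _ => rfl
  rw [← hy, hnorm, map_prod, ← Finset.prod_fiberwise_of_maps_to (s := Finset.univ) (t := T)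
    (g := fun σ : k →+* Qbar => comap σ (basePoint q)) fun σ _ =>
      (hT _).2 ((over_comap_iff σ).2 hy)]
  refine Finset.prod_congr rfl fun v hv => ?_
  have hcard : (Finset.univ.filter fun σ : k →+* Qbar => comap σ (basePoint q) = v).card =
      v.localDegree := by
    rw [← natCard_comap_eq_localDegree ((hT v).1 hv) hy, Nat.card_eq_fintype_card,
      Fintype.card_subtype]
  rw [← hcard]
  refine (Finset.prod_eq_pow_card fun σ hσ => ?_).symm
  rw [← (Finset.mem_filter.1 hσ).2, comap_abv_apply]

lemma prod_abv_pow_localDegree {S : Finset (Place k)} {x : k} (hx : x ≠ 0)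
    (hxS : ∀ v, v ∉ S → v.abv x = 1) : ∏ v ∈ S, v.abv x ^ v.localDegree = 1 := by
  classical
  choose q hq using fun v : Place k => v.exists_over
  let T (r : Option Nat.Primes) : Finset (Place k) := (finite_over r).toFinset
  have hT (r : Option Nat.Primes) (v : Place k) : v ∈ T r ↔ v.Over r := (finite_over r).mem_toFinset
  obtain ⟨Q, hQ, hSQ⟩ := ((eventually_prod_ratAbv ((Algebra.norm_ne_zero_iff (R := ℚ)).2 hx)).and
    (eventually_ge_atTop (S.image q))).exists
  have hST : S ⊆ Q.biUnion T := fun v hv => Finset.mem_biUnion.2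
    ⟨q v, hSQ (Finset.mem_image_of_mem q hv), (hT _ _).2 (hq v)⟩
  rw [Finset.prod_subset hST fun v _ hv => by rw [hxS v hv, one_pow], Finset.prod_biUnion]
  · rwa [Finset.prod_congr rfl fun r _ => prod_abv_pow_localDegree_over (hT r) x]
  · exact fun r _ r' _ hne => Finset.disjoint_left.2 fun v hr hr' =>
      hne (((hT _ _).1 hr).unique ((hT _ _).1 hr'))

end ProductFormula

end Place

section Determinants

open Matrix

variable {R : Type*} [CommRing R] [LinearOrder R] [IsStrictOrderedRing R]

lemma abs_intCast_eq_one_of_isUnit {n : ℤ} (hn : IsUnit n) : |(n : R)| = 1 := by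
  rw [← Int.cast_abs, Int.isUnit_iff_abs_eq.1 hn, Int.cast_one]

lemma abs_det_submatrix_eq_succAbove_zero {N : ℕ} (M : Matrix (Fin N) (Fin (N + 1)) R)
    (hM : ∀ i, ∑ j, M i j = 0) {c : Fin N → Fin (N + 1)} (hc : Function.Injective c) :
    |(M.submatrix id c).det| = |(M.submatrix id (Fin.succAbove 0)).det| := by
  obtain ⟨j, hj⟩ : ∃ j, ∀ n, c n ≠ j := by
    by_contra! h
    simpa using Fintype.card_le_of_surjective c h
  choose π hπ using fun n => Fin.exists_succAbove_eq (hj n)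
  have hπi : Function.Injective π := fun a b hab => hc (by rw [← hπ, ← hπ, hab])
  let p : Equiv.Perm (Fin N) := Equiv.ofBijective π (Finite.injective_iff_bijective.1 hπi)
  have hperm : M.submatrix id c = (M.submatrix id j.succAbove).submatrix id p := by
    ext a b
    exact congrArg (M a) (hπ b).symm
  rw [hperm, det_permute', submatrix_succAbove_det_eq_negOnePow_submatrix_succAbove_det' M hM j 0,
    abs_mul, abs_intCast_eq_one_of_isUnit p.sign.isUnit, one_mul, Units.smul_def, zsmul_eq_mul,
    abs_mul, abs_intCast_eq_one_of_isUnit (Units.isUnit _), one_mul]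

lemma abs_det_submatrix_eq {N : ℕ} {σ : Type*} [Fintype σ] (hσ : Fintype.card σ = N + 1)
    {M : Matrix (Fin N) σ R} (hM : ∀ i, ∑ j, M i j = 0) {c c' : Fin N → σ}
    (hc : Function.Injective c) (hc' : Function.Injective c') :
    |(M.submatrix id c).det| = |(M.submatrix id c').det| := by
  let e : σ ≃ Fin (N + 1) := Fintype.equivFinOfCardEq hσ
  have hreindex (c : Fin N → σ) :
      M.submatrix id c = (M.submatrix id e.symm).submatrix id (e ∘ c) := by
    ext
    simp
  have hM' (i : Fin N) : ∑ j, M.submatrix id e.symm i j = 0 :=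
    (Fintype.sum_equiv e.symm _ _ fun _ => rfl).trans (hM i)
  rw [hreindex c, hreindex c', abs_det_submatrix_eq_succAbove_zero _ hM' (e.injective.comp hc),
    abs_det_submatrix_eq_succAbove_zero _ hM' (e.injective.comp hc')]

lemma sum_abs_det_submatrix {m σ : Type*} [Fintype m] [DecidableEq m] [Fintype σ]
    {M : Matrix m σ R} {r : R}
    (hM : ∀ c : m → σ, Function.Injective c → |(M.submatrix id c).det| = r) :
    ∑ c : m → σ, |(M.submatrix id c).det| =
      (Fintype.card σ).descFactorial (Fintype.card m) * r := by
  classical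
  have hdet (c : m → σ) :
      |(M.submatrix id c).det| = if Function.Injective c then r else 0 := by
    split_ifs with hc
    · exact hM c hc
    · obtain ⟨a, b, hab, hne⟩ := Function.not_injective_iff.1 hc
      rw [det_zero_of_column_eq hne fun i => congrArg (M i) hab, abs_zero]
  rw [Finset.sum_congr rfl fun c _ => hdet c, ← Finset.sum_filter, Finset.sum_const, nsmul_eq_mul,
    ← Fintype.card_subtype, Fintype.card_congr (Equiv.subtypeInjectiveEquivEmbedding m σ),
    Fintype.card_embedding_eq]

lemma abs_det_basis_eq {ι M : Type*} [Fintype ι] [DecidableEq ι] [AddCommGroup M]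
    (b b' : Module.Basis ι ℤ M) (L : ι → M →+ R) :
    |(Matrix.of fun l n => L n (b l)).det| = |(Matrix.of fun l n => L n (b' l)).det| := by
  have hchange : (Matrix.of fun l n => L n (b l)) =
      ((b'.toMatrix b).map (Int.cast : ℤ → R))ᵀ * Matrix.of fun l n => L n (b' l) := by
    ext l n
    rw [mul_apply, of_apply]
    conv_lhs => rw [← b'.sum_repr (b l), map_sum]
    refine Finset.sum_congr rfl fun m _ => ?_
    rw [map_zsmul, zsmul_eq_mul]
    rfl
  have hunit : IsUnit (b'.toMatrix b).det := b'.isUnit_det b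
  rw [hchange, det_mul, det_transpose, abs_mul, ← Int.cast_det,
    abs_intCast_eq_one_of_isUnit hunit, one_mul]

end Determinants

lemma integral_pi_comp_eq_sum {X P ι E : Type*} [Fintype ι] [DecidableEq ι]
    [MeasurableSpace X] [NormedAddCommGroup E] [NormedSpace ℝ E] [CompleteSpace E]
    (μ : Measure X) [SigmaFinite μ] {π : X → P} {S : Finset P}
    (hmeas : ∀ v ∈ S, MeasurableSet (π ⁻¹' {v}))
    (hfin : ∀ v ∈ S, μ (π ⁻¹' {v}) ≠ ∞) {g : (ι → P) → E}
    (hg : ∀ z : ι → P, (∃ i, z i ∉ S) → g z = 0) :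
    ∫ y, g (π ∘ y) ∂(Measure.pi fun _ : ι => μ) =
      ∑ c : ι → S, (∏ i, μ.real (π ⁻¹' {(c i : P)})) • g fun i => c i := by
  classical
  let B (c : ι → S) : Set (ι → X) := Set.univ.pi fun i => π ⁻¹' {(c i : P)}
  have hB (c : ι → S) : MeasurableSet (B c) :=
    MeasurableSet.univ_pi fun i => hmeas _ (c i).2
  have hBfin (c : ι → S) : Measure.pi (fun _ : ι => μ) (B c) ≠ ∞ := by
    rw [Measure.pi_pi]
    exact ENNReal.prod_ne_top fun i _ => hfin _ (c i).2
  have hsum (y : ι → X) : g (π ∘ y) = ∑ c, (B c).indicator (fun _ => g fun i => c i) y := by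
    by_cases hy : ∀ i, π (y i) ∈ S
    · let c₀ (i : ι) : S := ⟨π (y i), hy i⟩
      have hc₀ : y ∈ B c₀ := fun _ _ => rfl
      rw [Finset.sum_eq_single_of_mem c₀ (Finset.mem_univ _) fun c _ hc =>
        Set.indicator_of_notMem (fun h => hc (funext fun i => Subtype.ext (h i trivial).symm)) _,
        Set.indicator_of_mem hc₀]
      rfl
    · obtain ⟨i, hi⟩ := not_forall.1 hy
      rw [hg _ ⟨i, hi⟩, Finset.sum_eq_zero]
      refine fun c _ => Set.indicator_of_notMem (fun h => hi ?_) _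
      exact (show π (y i) = c i from h i trivial) ▸ (c i).2
  simp_rw [hsum]
  rw [integral_finsetSum _ fun c _ =>
    (integrable_indicator_iff (hB c)).2 (integrableOn_const (hBfin c))]
  refine Finset.sum_congr rfl fun c _ => ?_
  rw [integral_indicator_const _ (hB c), measureReal_def, Measure.pi_pi, ENNReal.toReal_prod]
  rfl

section Image

lemma ker_mk'_torsion_comp {G H : Type*} [CommGroup G] [CommGroup H] {f : G →* H}
    (hf : Function.Injective f) :
    ((QuotientGroup.mk' (CommGroup.torsion H)).comp f).ker = CommGroup.torsion G := by
  ext u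
  rw [MonoidHom.mem_ker, MonoidHom.comp_apply, QuotientGroup.mk'_apply, QuotientGroup.eq_one_iff]
  exact hf.isOfFinOrder_iff

variable {k : Type*} [Field k] [CharZero k]

/-- The homomorphism `log ‖·‖_v` on the `S`-units modulo torsion. -/
noncomputable def sUnitsLog (S : Finset (Place k)) (v : Place k) :
    Additive (sUnits S ⧸ CommGroup.torsion (sUnits S)) →+ ℝ :=
  MonoidHom.toAdditiveLeft (QuotientGroup.lift (CommGroup.torsion (sUnits S))
    ((logAbv v.abv).comp (sUnits S).subtype) fun u hu => by
      have h : v.abv ((u : kˣ) : k) = 1 :=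
        abv_eq_one_of_isOfFinOrder v.abv ((sUnits S).subtype.isOfFinOrder hu)
      simp [logAbv, h])

lemma sUnitsLog_mk {S : Finset (Place k)} (v : Place k) (u : sUnits S) :
    sUnitsLog S v (Additive.ofMul (QuotientGroup.mk u)) = Real.log (v.abv ((u : kˣ) : k)) := rfl

lemma sUnitsLog_eq_zero_of_notMem {S : Finset (Place k)} {v : Place k} (hv : v ∉ S)
    (x : Additive (sUnits S ⧸ CommGroup.torsion (sUnits S))) : sUnitsLog S v x = 0 := by
  obtain ⟨u, rfl⟩ := QuotientGroup.mk_surjective x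
  exact (sUnitsLog_mk v u).trans (by rw [u.2 v hv, Real.log_one])

lemma sum_localDegree_mul_sUnitsLog {k : Type*} [Field k] [NumberField k] {S : Finset (Place k)}
    (x : Additive (sUnits S ⧸ CommGroup.torsion (sUnits S))) :
    ∑ v ∈ S, (v.localDegree : ℝ) * sUnitsLog S v x = 0 := by
  obtain ⟨u, rfl⟩ := QuotientGroup.mk_surjective x
  have hu := Place.prod_abv_pow_localDegree (u : kˣ).ne_zero u.2
  calc ∑ v ∈ S, (v.localDegree : ℝ) * Real.log (v.abv ((u : kˣ) : k))
      = Real.log (∏ v ∈ S, v.abv ((u : kˣ) : k) ^ v.localDegree) := by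
        rw [Real.log_prod fun v _ => pow_ne_zero _ (v.abv.ne_zero (u : kˣ).ne_zero)]
        simp only [Real.log_pow]
    _ = 0 := by rw [hu, Real.log_one]

variable [Algebra k Qbar]

/-- The embedding of the `S`-units of `k` in the multiplicative group of `ℚ̄`. -/
noncomputable def sUnitsEmbedding (S : Finset (Place k)) : sUnits S →* Qbarˣ :=
  (Units.map (algebraMap k Qbar : k →* Qbar)).comp (sUnits S).subtype

lemma sUnitsEmbedding_injective (S : Finset (Place k)) :
    Function.Injective (sUnitsEmbedding S) :=
  (Units.map_injective (algebraMap k Qbar).injective).comp Subtype.val_injective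

lemma range_mk'_torsion_comp_sUnitsEmbedding (S : Finset (Place k)) :
    ((QuotientGroup.mk' (CommGroup.torsion Qbarˣ)).comp (sUnitsEmbedding S)).range =
      sUnitsImage S := by
  rw [sUnitsEmbedding, ← MonoidHom.comp_assoc, MonoidHom.range_comp, Subgroup.range_subtype,
    sUnitsImage]

/-- The isomorphism of the `S`-units modulo torsion with their image in `𝒢`. -/
noncomputable def sUnitsImageEquiv (S : Finset (Place k)) :
    Additive (sUnits S ⧸ CommGroup.torsion (sUnits S)) ≃ₗ[ℤ] Additive (sUnitsImage S) :=
  (MulEquiv.toAdditive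
    (((QuotientGroup.quotientMulEquivOfEq
      (ker_mk'_torsion_comp (sUnitsEmbedding_injective S)).symm).trans
        (QuotientGroup.quotientKerEquivRange _)).trans
          (MulEquiv.subgroupCongr (range_mk'_torsion_comp_sUnitsEmbedding S)))).toIntLinearEquiv

lemma logFun_sUnitsImageEquiv {S : Finset (Place k)}
    (x : Additive (sUnits S ⧸ CommGroup.torsion (sUnits S))) (y : Place Qbar) :
    logFun ((sUnitsImageEquiv S x).toMul : GroupG) y = sUnitsLog S (y.restrict k) x := by
  obtain ⟨u, rfl⟩ := QuotientGroup.mk_surjective x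
  exact (sUnitsLog_mk (y.restrict k) u).symm

end Image

lemma height_eq_of_forall_basis {A : Subgroup GroupG} [Module.Finite ℤ (Additive A)]
    [Module.Free ℤ (Additive A)] {N : ℕ} (hN : Module.finrank ℤ (Additive A) = N) {a : ℝ}
    (h : ∀ b : Module.Basis (Fin N) ℤ (Additive A), ∫ y : Fin N → Place Qbar,
      |deltaDet (fun l => logFun ((b l).toMul : GroupG)) y|
        ∂(Measure.pi fun _ => placeMeasure) = a) :
    height A = (2 ^ N)⁻¹ * a := by
  subst hN
  rw [height, dif_pos ⟨Module.finBasis ℤ _⟩, h]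

section Regulator

variable {k : Type*} [Field k] [NumberField k] {S : Finset (Place k)}

/-- The matrix `([k_v : ℚ_v] log ‖η_l‖_v)` of a family of `S`-units modulo torsion, whose columns
are indexed by all places in `S`. -/
noncomputable def sUnitsLogMatrix {ι : Type*}
    (η : ι → Additive (sUnits S ⧸ CommGroup.torsion (sUnits S))) : Matrix ι S ℝ :=
  Matrix.of fun l v => (v.1.localDegree : ℝ) * sUnitsLog S v (η l)

lemma sum_sUnitsLogMatrix {ι : Type*}
    (η : ι → Additive (sUnits S ⧸ CommGroup.torsion (sUnits S))) (l : ι) :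
    ∑ v, sUnitsLogMatrix η l v = 0 :=
  (Finset.sum_coe_sort S fun v => (v.localDegree : ℝ) * sUnitsLog S v (η l)).trans
    (sum_localDegree_mul_sUnitsLog (η l))

lemma integral_abs_det_sUnitsLog [Algebra k Qbar] {ι : Type*} [Fintype ι] [DecidableEq ι]
    (η : ι → Additive (sUnits S ⧸ CommGroup.torsion (sUnits S))) :
    ∫ y : ι → Place Qbar, |(Matrix.of fun l n => sUnitsLog S ((y n).restrict k) (η l)).det|
        ∂(Measure.pi fun _ => placeMeasure) =
      ((Module.finrank ℚ k : ℝ) ^ Fintype.card ι)⁻¹ *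
        ∑ c : ι → S, |((sUnitsLogMatrix η).submatrix id c).det| := by
  have hfin (v : Place k) : placeMeasure v.fiber ≠ ∞ := by
    rw [Place.placeMeasure_fiber]
    exact ENNReal.div_ne_top (by simp) (mod_cast (Module.finrank_pos (R := ℚ) (M := k)).ne')
  have hzero (z : ι → Place k) (hz : ∃ n, z n ∉ S) :
      |(Matrix.of fun l n => sUnitsLog S (z n) (η l)).det| = 0 := by
    obtain ⟨n, hn⟩ := hz
    rw [Matrix.det_eq_zero_of_column_eq_zero n fun l => sUnitsLog_eq_zero_of_notMem hn _, abs_zero]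
  refine (integral_pi_comp_eq_sum (π := Place.restrict k) placeMeasure
    (fun v _ => v.measurableSet_fiber) (fun v _ => hfin v) hzero).trans ?_
  rw [Finset.mul_sum]
  refine Finset.sum_congr rfl fun c _ => ?_
  have hmeasure (n : ι) : placeMeasure.real (Place.restrict k ⁻¹' {((c n : S) : Place k)}) =
      (Module.finrank ℚ k : ℝ)⁻¹ * (c n).1.localDegree := by
    rw [measureReal_def]
    refine (congrArg ENNReal.toReal (c n).1.placeMeasure_fiber).trans ?_
    rw [ENNReal.toReal_div, ENNReal.toReal_natCast, ENNReal.toReal_natCast, div_eq_inv_mul]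
  have hdet : ((sUnitsLogMatrix η).submatrix id c).det = (∏ n, ((c n).1.localDegree : ℝ)) *
      (Matrix.of fun l n => sUnitsLog S (c n) (η l)).det :=
    Matrix.det_mul_row _ _
  simp only [hmeasure, hdet, abs_mul, Finset.abs_prod, Nat.abs_cast, Finset.prod_mul_distrib,
    Finset.prod_const, Finset.card_univ, inv_pow, smul_eq_mul, mul_assoc]

lemma nonempty_regulatorData (hS : ∀ v : Place k, v.IsArchimedean → v ∈ S)
    (hne : S.Nonempty) : Nonempty (RegulatorData S) := by
  classical
  obtain ⟨v₀, hv₀⟩ := hne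
  have := finite_sUnits_quotient_torsion hS
  have hcard : Fintype.card {v : Place k // v ∈ S.erase v₀} = S.card - 1 := by
    rw [Fintype.card_coe, Finset.card_erase_of_mem hv₀]
  let b := (Module.finBasisOfFinrankEq ℤ (Additive (sUnits S ⧸ CommGroup.torsion (sUnits S)))
    (finrank_sUnits_quotient_torsion hS)).reindex ((Fintype.equivFinOfCardEq hcard).symm.trans
      (Equiv.subtypeEquivRight fun v => by rw [Finset.mem_erase, and_comm]))
  choose η hη using fun i => QuotientGroup.mk_surjective (b i).toMul
  exact ⟨⟨v₀, hv₀, η, b, fun i => congrArg Additive.ofMul (hη i).symm⟩⟩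

lemma RegulatorData.abs_det_eq (D : RegulatorData S)
    {_ : Fintype {v : Place k // v ∈ S ∧ v ≠ D.v₀}}
    {_ : DecidableEq {v : Place k // v ∈ S ∧ v ≠ D.v₀}}
    {N : ℕ} (hN : S.card = N + 1)
    (b : Module.Basis (Fin N) ℤ (Additive (sUnits S ⧸ CommGroup.torsion (sUnits S))))
    {c : Fin N → S} (hc : Function.Injective c) :
    |(Matrix.of fun l v : {v : Place k // v ∈ S ∧ v ≠ D.v₀} =>
      (v.1.localDegree : ℝ) * Real.log (v.1.abv ((D.η l : kˣ) : k))).det| =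
      |((sUnitsLogMatrix b).submatrix id c).det| := by
  classical
  obtain ⟨b', hb'⟩ := D.fundamental
  have hcard : Fintype.card {v : Place k // v ∈ S ∧ v ≠ D.v₀} = N := by
    rw [Fintype.card_of_subtype (S.erase D.v₀) fun v => by rw [Finset.mem_erase, and_comm],
      Finset.card_erase_of_mem D.mem, hN, Nat.add_sub_cancel]
  let e := (Fintype.equivFinOfCardEq hcard).symm
  let c' (n : Fin N) : S := ⟨(e n).1, (e n).2.1⟩
  have hc' : Function.Injective c' := fun n n' h =>
    e.injective (Subtype.ext (congrArg (fun v : S => (v : Place k)) h))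
  let L (n : Fin N) : Additive (sUnits S ⧸ CommGroup.torsion (sUnits S)) →+ ℝ :=
    (AddMonoidHom.mulLeft ((c' n).1.localDegree : ℝ)).comp (sUnitsLog S (c' n))
  rw [abs_det_submatrix_eq (by rw [Fintype.card_coe, hN]) (sum_sUnitsLogMatrix b) hc hc',
    ← Matrix.det_submatrix_equiv_self e]
  refine Eq.trans ?_ (abs_det_basis_eq (b'.reindex e.symm) b L)
  congr 2
  ext l n
  rw [Matrix.of_apply, Module.Basis.reindex_apply, Equiv.symm_symm, hb']
  exact congrArg (fun t : ℝ => (e n).1.localDegree * t) (sUnitsLog_mk (e n).1 (D.η (e l))).symm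

lemma sRegulator_eq_abs_det (hS : ∀ v : Place k, v.IsArchimedean → v ∈ S) {N : ℕ}
    (hN : S.card = N + 1)
    (b : Module.Basis (Fin N) ℤ (Additive (sUnits S ⧸ CommGroup.torsion (sUnits S))))
    {c : Fin N → S} (hc : Function.Injective c) :
    sRegulator S = |((sUnitsLogMatrix b).submatrix id c).det| := by
  rw [sRegulator, dif_pos (nonempty_regulatorData hS (Finset.card_pos.1 (by lia)))]
  exact RegulatorData.abs_det_eq _ hN b hc

lemma integral_abs_deltaDet_sUnitsImage [Algebra k Qbar]
    (hS : ∀ v : Place k, v.IsArchimedean → v ∈ S) {N : ℕ} (hN : S.card = N + 1)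
    (b : Module.Basis (Fin N) ℤ (Additive (sUnitsImage S))) :
    ∫ y : Fin N → Place Qbar, |deltaDet (fun l => logFun ((b l).toMul : GroupG)) y|
        ∂(Measure.pi fun _ => placeMeasure) =
      ((Module.finrank ℚ k : ℝ) ^ N)⁻¹ * ((N + 1)! * sRegulator S) := by
  let η := b.map (sUnitsImageEquiv S).symm
  have hlog (l : Fin N) (y : Place Qbar) :
      logFun ((b l).toMul : GroupG) y = sUnitsLog S (y.restrict k) (η l) := by
    rw [← logFun_sUnitsImageEquiv, Module.Basis.map_apply, LinearEquiv.apply_symm_apply]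
  have hdesc : (N + 1).descFactorial N = (N + 1)! := by
    simpa using Nat.factorial_mul_descFactorial (Nat.le_succ N)
  simp only [deltaDet, hlog]
  rw [integral_abs_det_sUnitsLog, Fintype.card_fin,
    sum_abs_det_submatrix fun c hc => (sRegulator_eq_abs_det hS hN η hc).symm, Fintype.card_coe,
    Fintype.card_fin, hN, hdesc]

end Regulator

/-- The group `𝔘_S(k)` is finitely generated of rank `s - 1`, and its height is
`s! Reg_S(k) / (2 [k : ℚ]) ^ (s - 1)`. -/
theorem theorem2 (k : Type*) [Field k] [NumberField k] [Algebra k Qbar]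
    (S : Finset (Place k)) (hS : ∀ v : Place k, v.IsArchimedean → v ∈ S)
    (s : ℕ) (hs : S.card = s) (hs2 : 2 ≤ s) :
    (sUnitsImage S).FG ∧
    Module.finrank ℤ (Additive (sUnitsImage S)) = s - 1 ∧
    height (sUnitsImage S) =
      (s ! : ℝ) * sRegulator S / (2 * (Module.finrank ℚ k : ℝ)) ^ (s - 1) := by
  obtain ⟨N, rfl⟩ : ∃ N, s = N + 1 := ⟨s - 1, by lia⟩
  have := finite_sUnits_quotient_torsion hS
  have hfinite : Module.Finite ℤ (Additive (sUnitsImage S)) := .equiv (sUnitsImageEquiv S)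
  have hfree : Module.Free ℤ (Additive (sUnitsImage S)) := .of_equiv (sUnitsImageEquiv S)
  have hrank : Module.finrank ℤ (Additive (sUnitsImage S)) = N := by
    rw [← (sUnitsImageEquiv S).finrank_eq, finrank_sUnits_quotient_torsion hS, hs,
      Nat.add_sub_cancel]
  refine ⟨?_, hrank, ?_⟩
  · rwa [← Group.fg_iff_subgroup_fg, GroupFG.iff_add_fg, ← Module.Finite.iff_addGroup_fg]
  · rw [height_eq_of_forall_basis hrank (integral_abs_deltaDet_sUnitsImage hS hs),
      Nat.add_sub_cancel, mul_pow]
    field_simp
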